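/- **Theorem.** Let $f:\mathbb{R}^m\times\mathbb{R}^n\to\mathbb{R}$ be $\ell$-smooth ($f$ is differentiable and $\|\nabla f(z)-\nabla f(z')\|\le \ell\|z-z'\|$ for all $z,z'$, Euclidean norms), let $\mathcal{Y}\subseteq\mathbb{R}^n$ be closed, convex and bounded with diameter $D>0$, and suppose that $f(\cdot,\mathbf y)$ is $L$-Lipschitz for each $\mathbf y\in\mathcal Y$ and $f(\mathbf x,\cdot)$ is concave on $\mathcal Y$ for each $\mathbf x$, where $\ell,L>0$. Put $\Phi(\mathbf x)=\max_{\mathbf y\in\mathcal Y}f(\mathbf x,\mathbf y)$ and assume that $\Phi$ is bounded below. Let $\Phi_{1/2\ell}(\mathbf x)=\min_{\mathbf w}\{\Phi(\mathbf w)+\ell\|\mathbf w-\mathbf x\|^2\}$ be its Moreau envelope. Let $\epsilon>0$, $\mathbf x_0\in\mathbb{R}^m$, $\mathbf y_0\in\mathcal Y$, $\Delta_\Phi=\Phi(\mathbf x_0)-\inf_{\mathbf x}\Phi(\mathbf x)$ and $\Delta_0=\Phi(\mathbf x_0)-f(\mathbf x_0,\mathbf y_0)$. Then $\Phi$ is $\ell$-weakly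 convex (i.e. $\Phi+\frac{\ell}{2}\|\cdot\|^2$ is convex), $\Phi_{1/2\ell}$ is differentiable, and the following statements hold with a constant $C>0$ that is absolute (independent of $f,\mathcal Y,m,n$ and of all parameters). A point $\mathbf x$ is called $\epsilon$-stationary if $\|\nabla\Phi_{1/2\ell}(\mathbf x)\|\le\epsilon$, and a random point $\hat{\mathbf x}$ is called $\epsilon$-stationary in mean square if $\mathbb{E}\|\nabla\Phi_{1/2\ell}(\hat{\mathbf x})\|^2\le\epsilon^2$. $\mathcal P_{\mathcal Y}$ denotes the orthogonal projection onto $\mathcal Y$. 1. (TTGDA) Let $\mathbf x_{t}=\mathbf x_{t-1}-\eta_{\mathbf x}\nabla_{\mathbf x}f(\mathbf x_{t-1},\mathbf y_{t-1})$ and $\mathbf y_{t}=\mathcal P_{\mathcal Y}(\mathbf y_{t-1}+\eta_{\mathbf y}\nabla_{\mathbf y}f(\mathbf x_{t-1},\mathbf y_{t-1}))$ with $$\eta_{\mathbf x}=\min\Big\{\tfrac{\epsilon^2}{80\ell L^2},\tfrac{\epsilon^4}{4096\ell^3L^2D^2}\Big\},\qquad \eta_{\mathbf y}=\tfrac1\ell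 .$$ There is an $N$ such that the first $N$ iterations use at most $$C\Big(\tfrac{\ell L^2\Delta_\Phi}{\epsilon^4}+\tfrac{\ell\Delta_0}{\epsilon^2}\Big)\max\Big\{1,\tfrac{\ell^2D^2}{\epsilon^2}\Big\}$$ gradient evaluations (one per iteration) and, for every $T\ge N$, the returned point $\hat{\mathbf x}$, drawn uniformly at random from $\{\mathbf x_0,\dots,\mathbf x_T\}$, is $\epsilon$-stationary in mean square; moreover some $\mathbf x_t$ with $t\le T$ is $\epsilon$-stationary. 2. (TTSGDA, $M=1$) Let $\sigma\ge0$ and let $G(\mathbf x,\mathbf y,\xi)=(G_{\mathbf x},G_{\mathbf y})$ be a jointly measurable stochastic gradient with $\mathbb{E}[G(\mathbf x,\mathbf y,\xi)]=\nabla f(\mathbf x,\mathbf y)$ and $\mathbb{E}\|G(\mathbf x,\mathbf y,\xi)-\mathbb{E}[G(\mathbf x,\mathbf y,\xi)]\|^2\le\sigma^2$ for all $\mathbf x\in\mathbb{R}^m$, $\mathbf y\in\mathcal Y$. Run the iteration of part 1 with $\nabla f(\mathbf x_{t-1},\mathbf y_{t-1})$ replaced by $G(\mathbf x_{t-1},\mathbf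 y_{t-1},\xi^{t-1})$, where $\xi^0,\xi^1,\dots$ are i.i.d. copies of $\xi$, and with $$\eta_{\mathbf x}=\min\Big\{\tfrac{\epsilon^2}{80\ell(L^2+\sigma^2)},\tfrac{\epsilon^4}{8192\ell^3(L^2+\sigma^2)D^2},\tfrac{\epsilon^6}{131072\ell^3(L^2+\sigma^2)D^2\sigma^2}\Big\},\qquad \eta_{\mathbf y}=\min\Big\{\tfrac1{2\ell},\tfrac{\epsilon^2}{32\ell\sigma^2}\Big\}$$ (a term with $\sigma=0$ in the denominator is read as $+\infty$). There is an $N$ such that the first $N$ iterations use at most $$C\Big(\tfrac{\ell(L^2+\sigma^2)\Delta_\Phi}{\epsilon^4}+\tfrac{\ell\Delta_0}{\epsilon^2}\Big)\max\Big\{1,\tfrac{\ell^2D^2}{\epsilon^2},\tfrac{\ell^2D^2\sigma^2}{\epsilon^4}\Big\}$$ stochastic gradient evaluations (one per iteration) and, for every $T\ge N$, the returned point $\hat{\mathbf x}$, drawn uniformly at random from $\{\mathbf x_0,\dots,\mathbf x_T\}$ independently of the samples, is $\epsilon$-stationary in mean square, the expectation being over the samples and the draw. -/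

import Mathlib

open MeasureTheory ProbabilityTheory

noncomputable section

namespace TwoTimescale

/-- `ℝᵈ` with the Euclidean norm. -/
abbrev Vec (d : ℕ) : Type := EuclideanSpace ℝ (Fin d)

/-- `ℝᵐ × ℝⁿ` with the Euclidean norm `‖(x, y)‖² = ‖x‖² + ‖y‖²`. -/
abbrev VecPair (m n : ℕ) : Type := WithLp 2 (Vec m × Vec n)

/-- The pair `(x, y)` as a point of the Euclidean space `ℝᵐ × ℝⁿ`. -/
def mkPair {m n : ℕ} (x : Vec m) (y : Vec n) : VecPair m n := WithLp.toLp 2 (x, y)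

/-- `f` is `ℓ`-smooth: differentiable with `ℓ`-Lipschitz gradient. -/
def IsSmooth {E : Type*} [NormedAddCommGroup E] [InnerProductSpace ℝ E] [CompleteSpace E]
    (ℓ : ℝ) (f : E → ℝ) : Prop :=
  Differentiable ℝ f ∧ ∀ z z' : E, ‖gradient f z - gradient f z'‖ ≤ ℓ * ‖z - z'‖

/-- `φ` is `ρ`-weakly convex: `φ + (ρ/2)‖·‖²` is convex. -/
def IsWeaklyConvex {E : Type*} [NormedAddCommGroup E] [InnerProductSpace ℝ E]
    (ρ : ℝ) (φ : E → ℝ) : Prop :=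
  ConvexOn ℝ Set.univ fun x => φ x + ρ / 2 * ‖x‖ ^ 2

/-- The Moreau envelope `φ_lam(x) = min_w φ(w) + ‖w - x‖² / (2 lam)`. -/
def moreauEnvelope {E : Type*} [NormedAddCommGroup E] (φ : E → ℝ) (lam : ℝ) (x : E) : ℝ :=
  ⨅ w : E, φ w + 1 / (2 * lam) * ‖w - x‖ ^ 2

/-- `x` is an `ε`-stationary point of the `ρ`-weakly convex function `φ`:
`‖∇φ_{1/2ρ}(x)‖ ≤ ε`. -/
def IsStationary {E : Type*} [NormedAddCommGroup E] [InnerProductSpace ℝ E] [CompleteSpace E]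
    (φ : E → ℝ) (ρ ε : ℝ) (x : E) : Prop :=
  IsWeaklyConvex ρ φ ∧
    DifferentiableAt ℝ (moreauEnvelope φ (1 / (2 * ρ))) x ∧
    ‖gradient (moreauEnvelope φ (1 / (2 * ρ))) x‖ ≤ ε

/-- A random point `X` is an `ε`-stationary point (in mean square) of the `ρ`-weakly convex
function `φ`: `𝔼 ‖∇φ_{1/2ρ}(X)‖² ≤ ε²`. By Jensen's inequality this contains
`𝔼 ‖∇φ_{1/2ρ}(X)‖ ≤ ε`. -/
def IsStationaryInMeanSquare {E : Type*} [NormedAddCommGroup E] [InnerProductSpace ℝ E]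
    [CompleteSpace E] {Ω : Type*} [MeasurableSpace Ω] (P : Measure Ω)
    (φ : E → ℝ) (ρ ε : ℝ) (X : Ω → E) : Prop :=
  IsWeaklyConvex ρ φ ∧
    Differentiable ℝ (moreauEnvelope φ (1 / (2 * ρ))) ∧
    Integrable (fun ω => ‖gradient (moreauEnvelope φ (1 / (2 * ρ))) (X ω)‖ ^ 2) P ∧
    ∫ ω, ‖gradient (moreauEnvelope φ (1 / (2 * ρ))) (X ω)‖ ^ 2 ∂P ≤ ε ^ 2

/-- The objective as a function of the joint variable `(x, y)`. -/
def joint {m n : ℕ} (f : Vec m → Vec n → ℝ) : VecPair m n → ℝ := fun z => f z.fst z.snd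

/-- The gradient `∇f(x, y) = (∇ₓf(x, y), ∇_y f(x, y))`. -/
def grad {m n : ℕ} (f : Vec m → Vec n → ℝ) (x : Vec m) (y : Vec n) : VecPair m n :=
  gradient (joint f) (mkPair x y)

/-- `Φ(x) = max_{y ∈ Y} f(x, y)`. -/
def maxFun {m n : ℕ} (f : Vec m → Vec n → ℝ) (Y : Set (Vec n)) (x : Vec m) : ℝ :=
  ⨆ y : Y, f x y

/-- `Φ` is an attained maximum for continuous `f` and nonempty compact `Y`. -/
theorem maxFun_isGreatest {m n : ℕ} (f : Vec m → Vec n → ℝ) (Y : Set (Vec n)) (x : Vec m)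
    (hf : Continuous (f x)) (hY : IsCompact Y) (hne : Y.Nonempty) :
    IsGreatest (f x '' Y) (maxFun f Y x) := by
  have h := (hY.image hf).isGreatest_sSup (hne.image _)
  rwa [sSup_image'] at h

/-- `f` is `ℓ`-smooth, and, over the constraint set `Y`, `L`-Lipschitz in `x` and concave in `y`;
`Y` is closed, convex and bounded with diameter `D > 0`. -/
structure SmoothNonconvexConcave {m n : ℕ} (f : Vec m → Vec n → ℝ) (Y : Set (Vec n))
    (ℓ L D : ℝ) : Prop where
  ell_pos : 0 < ℓ
  L_pos : 0 < L
  D_pos : 0 < D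
  smooth : IsSmooth ℓ (joint f)
  lipschitz : ∀ y ∈ Y, ∀ x x' : Vec m, |f x y - f x' y| ≤ L * ‖x - x'‖
  concave : ∀ x, ConcaveOn ℝ Y (f x)
  convex : Convex ℝ Y
  closed : IsClosed Y
  bounded : Bornology.IsBounded Y
  diam : Metric.diam Y = D

/-- The orthogonal projection onto `Y`: a nearest point of `Y` (it exists and is unique if `Y` is
nonempty, closed and convex; the value is irrelevant if there is no nearest point). -/
def proj {d : ℕ} (Y : Set (Vec d)) (z : Vec d) : Vec d :=
  open Classical in
  if h : ∃ p ∈ Y, ∀ q ∈ Y, ‖z - p‖ ≤ ‖z - q‖ then h.choose else z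

theorem proj_spec {d : ℕ} (Y : Set (Vec d)) (hY : IsClosed Y) (hne : Y.Nonempty) (z : Vec d) :
    proj Y z ∈ Y ∧ ∀ q ∈ Y, ‖z - proj Y z‖ ≤ ‖z - q‖ := by
  have h : ∃ p ∈ Y, ∀ q ∈ Y, ‖z - p‖ ≤ ‖z - q‖ := by
    obtain ⟨p, hp, hd⟩ := hY.exists_infDist_eq_dist hne z
    refine ⟨p, hp, fun q hq => ?_⟩
    rw [← dist_eq_norm, ← dist_eq_norm, ← hd]
    exact Metric.infDist_le_dist_of_mem hq
  unfold proj
  rw [dif_pos h]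
  exact h.choose_spec

/-- A state of the algorithms: the current iterates and the number of (stochastic) gradient
evaluations made so far. -/
structure State (m n : ℕ) where
  x : Vec m
  y : Vec n
  evals : ℕ

/-- One iteration with (estimated) gradient `g`, obtained at the price of `cost` evaluations:
`x ← x - ηx g_x`, `y ← P_Y(y + ηy g_y)`. -/
def State.step {m n : ℕ} (Y : Set (Vec n)) (ηx ηy : ℝ) (g : VecPair m n) (cost : ℕ)
    (s : State m n) : State m n where
  x := s.x - ηx • g.fst
  y := proj Y (s.y + ηy • g.snd)
  evals := s.evals + cost

/-- The state of TTGDA after `t` iterations, started at `(x₀, y₀)`, with step sizes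
`ηx t`, `ηy t`; each iteration evaluates `∇f` once. -/
def ttgda {m n : ℕ} (f : Vec m → Vec n → ℝ) (Y : Set (Vec n)) (ηx ηy : ℕ → ℝ)
    (x₀ : Vec m) (y₀ : Vec n) : ℕ → State m n
  | 0 => ⟨x₀, y₀, 0⟩
  | t + 1 =>
    let s := ttgda f Y ηx ηy x₀ y₀ t
    s.step Y (ηx t) (ηy t) (grad f s.x s.y) 1

/-- The mini-batch gradient estimator `(1/M) ∑ᵢ G(x, y, ξᵢ)`. -/
def SG {m n M : ℕ} {Ξ : Type*} (G : Vec m → Vec n → Ξ → VecPair m n) (ξ : Fin M → Ξ)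
    (x : Vec m) (y : Vec n) : VecPair m n :=
  (1 / (M : ℝ)) • ∑ i, G x y (ξ i)

/-- The state of TTSGDA after `t` iterations when the samples drawn in iteration `t` are
`ξ t 1, …, ξ t M`; each iteration makes `M` stochastic gradient evaluations. -/
def ttsgda {m n M : ℕ} {Ξ : Type*} (G : Vec m → Vec n → Ξ → VecPair m n) (Y : Set (Vec n))
    (ηx ηy : ℕ → ℝ) (x₀ : Vec m) (y₀ : Vec n) (ξ : ℕ → Fin M → Ξ) : ℕ → State m n
  | 0 => ⟨x₀, y₀, 0⟩
  | t + 1 =>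
    let s := ttsgda G Y ηx ηy x₀ y₀ ξ t
    s.step Y (ηx t) (ηy t) (SG G (ξ t) s.x s.y) M

/-- `G` with sample law `ν` is a stochastic gradient oracle for `f` on `ℝᵐ × Y`:
unbiased, with variance at most `σ²`. -/
structure IsStochasticGradient {m n : ℕ} {Ξ : Type*} [MeasurableSpace Ξ]
    (f : Vec m → Vec n → ℝ) (Y : Set (Vec n)) (G : Vec m → Vec n → Ξ → VecPair m n)
    (ν : Measure Ξ) (σ : ℝ) : Prop where
  sigma_nonneg : 0 ≤ σ
  isProbabilityMeasure : IsProbabilityMeasure ν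
  measurable : Measurable fun p : Vec m × Vec n × Ξ => G p.1 p.2.1 p.2.2
  square_integrable : ∀ x, ∀ y ∈ Y, MemLp (G x y) 2 ν
  unbiased : ∀ x, ∀ y ∈ Y, ∫ s, G x y s ∂ν = grad f x y
  variance_le : ∀ x, ∀ y ∈ Y, ∫ s, ‖G x y s - ∫ s', G x y s' ∂ν‖ ^ 2 ∂ν ≤ σ ^ 2

/-- The samples `ξ t i` are independent with common law `ν`. -/
structure IsSampling {Ω Ξ : Type*} [MeasurableSpace Ω] [MeasurableSpace Ξ] {M : ℕ}
    (P : Measure Ω) (ν : Measure Ξ) (ξ : ℕ → Fin M → Ω → Ξ) : Prop where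
  measurable : ∀ t i, Measurable (ξ t i)
  law : ∀ t i, P.map (ξ t i) = ν
  indep : iIndepFun (fun p : ℕ × Fin M => ξ p.1 p.2) P

/-- The uniform distribution on the indices `0, …, T`, used to draw the returned iterate. -/
def uniformIndex (T : ℕ) : Measure (Fin (T + 1)) :=
  (PMF.uniformOfFintype (Fin (T + 1))).toMeasure

/-- Step size in `x` for TTGDA. -/
def etaX (ℓ L D ε : ℝ) : ℝ :=
  min (ε ^ 2 / (80 * ℓ * L ^ 2)) (ε ^ 4 / (4096 * ℓ ^ 3 * L ^ 2 * D ^ 2))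

/-- Step size in `x` for TTSGDA; for `σ = 0` the last term of the minimum is `+∞`. -/
def etaXStoch (ℓ L D σ ε : ℝ) : ℝ :=
  open Classical in
  if σ = 0 then
    min (ε ^ 2 / (80 * ℓ * (L ^ 2 + σ ^ 2)))
      (ε ^ 4 / (8192 * ℓ ^ 3 * (L ^ 2 + σ ^ 2) * D ^ 2))
  else
    min (ε ^ 2 / (80 * ℓ * (L ^ 2 + σ ^ 2)))
      (min (ε ^ 4 / (8192 * ℓ ^ 3 * (L ^ 2 + σ ^ 2) * D ^ 2))
        (ε ^ 6 / (131072 * ℓ ^ 3 * (L ^ 2 + σ ^ 2) * D ^ 2 * σ ^ 2)))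

/-- Step size in `y` for TTSGDA; for `σ = 0` the last term of the minimum is `+∞`. -/
def etaYStoch (ℓ σ ε : ℝ) : ℝ :=
  open Classical in
  if σ = 0 then 1 / (2 * ℓ) else min (1 / (2 * ℓ)) (ε ^ 2 / (32 * ℓ * σ ^ 2))

/-- `(ℓL²Δ_Φ/ε⁴ + ℓΔ₀/ε²) max{1, ℓ²D²/ε²}`. -/
def boundDet (ℓ L D ΔΦ Δ₀ ε : ℝ) : ℝ :=
  (ℓ * L ^ 2 * ΔΦ / ε ^ 4 + ℓ * Δ₀ / ε ^ 2) * max 1 (ℓ ^ 2 * D ^ 2 / ε ^ 2)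

/-- `(ℓ(L²+σ²)Δ_Φ/ε⁴ + ℓΔ₀/ε²) max{1, ℓ²D²/ε², ℓ²D²σ²/ε⁴}`. -/
def boundStoch (ℓ L D σ ΔΦ Δ₀ ε : ℝ) : ℝ :=
  (ℓ * (L ^ 2 + σ ^ 2) * ΔΦ / ε ^ 4 + ℓ * Δ₀ / ε ^ 2) *
    max 1 (max (ℓ ^ 2 * D ^ 2 / ε ^ 2) (ℓ ^ 2 * D ^ 2 * σ ^ 2 / ε ^ 4))

end TwoTimescale

end

noncomputable section

namespace TwoTimescale

/-! ### Smooth functions -/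

/-! The Moreau envelope of `Φ` is a Lyapunov function. Testing it at the proximal point of the
current `x`, one step in `x` lowers the envelope by `ηx / 2` times its squared gradient norm, up to
`2 ηx ℓ` times the primal gap `Φ(x) - f(x, y)`, a noise term and a term of second order in `ηx`
(`descent_step`). After telescoping, the mean squared gradient is small as soon as `T` is large,
`ηx` is small and the average gap is of order `ε² / ℓ`.

The gap is treated as the regret of projected ascent in `y`. Against a comparator `z`, each ascent
step is paid for by the decrease of `‖z - y‖² / (2 ηy)` (`ascent_step`). Since `f(x, ·)` is merely
concave, its maximizers may jump as `x` moves, so `z` stays fixed on blocks of `B` iterations. Per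
iteration, the drift of `x` within a block then costs about `B ηx (L² + σ²)`, and renewing `z` costs
`D² / (2 ηy B)`; the values of `f` telescope across blocks. `B` is chosen to make the renewal cost
of order `ε² / ℓ`, and `ηx` is so small that the drift cost is too. The first block uses `y₀` as
comparator, which produces the term in `Δ₀`.

Noise enters linearly only against bounded vectors determined by the past, where its mean vanishes,
and quadratically with cost `ηy σ²`. `IsNoisyRun` records just these properties. TTGDA is the case
`σ = 0` on a one-point space, so `sum_integral_norm_gradient_sq_le_mul_sq` serves both parts;
drawing the index uniformly turns its sum into the required expectation. -/

theorem le_of_forall_le_add_mul {a b c : ℝ}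
    (h : ∀ t : ℝ, 0 < t → t ≤ 1 → a ≤ b + t * c) : a ≤ b := by
  by_contra hab
  push Not at hab
  have hc : 0 < |c| + 1 := by positivity
  -- With this `t`, the error `t * c` is at most half of `a - b`.
  have ht : 0 < min 1 ((a - b) / (2 * (|c| + 1))) :=
    lt_min one_pos (div_pos (sub_pos.2 hab) (by positivity))
  have h1 := h _ ht (min_le_left _ _)
  have h2 : min 1 ((a - b) / (2 * (|c| + 1))) * c ≤ (a - b) / (2 * (|c| + 1)) * (|c| + 1) :=
    calc _ ≤ min 1 ((a - b) / (2 * (|c| + 1))) * (|c| + 1) :=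
          mul_le_mul_of_nonneg_left (by linarith [le_abs_self c]) ht.le
      _ ≤ _ := mul_le_mul_of_nonneg_right (min_le_right _ _) hc.le
  have h3 : (a - b) / (2 * (|c| + 1)) * (|c| + 1) = (a - b) / 2 := by
    field_simp
  linarith

section Smooth

variable {E : Type*} [NormedAddCommGroup E] [InnerProductSpace ℝ E] [CompleteSpace E]
  {ℓ : ℝ} {F : E → ℝ}

/-- Along the segment from `z` to `w`, `F` minus its quadratic model has nonpositive derivative, by
Cauchy–Schwarz and the Lipschitz gradient. -/
theorem IsSmooth.le_quadratic (hF : IsSmooth ℓ F) (z w : E) :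
    F w ≤ F z + inner ℝ (gradient F z) (w - z) + ℓ / 2 * ‖w - z‖ ^ 2 := by
  set d := w - z with hd
  set ψ : ℝ → ℝ := fun t => F (z + t • d) - t * inner ℝ (gradient F z) d - ℓ / 2 * t ^ 2 * ‖d‖ ^ 2
  have hderiv : ∀ t, HasDerivAt ψ
      (inner ℝ (gradient F (z + t • d)) d - inner ℝ (gradient F z) d - ℓ * t * ‖d‖ ^ 2) t := by
    intro t
    have h1 : HasDerivAt (fun t : ℝ => z + t • d) d t := by
      simpa using ((hasDerivAt_id t).smul_const d).const_add z
    have h2 : HasDerivAt (fun t : ℝ => F (z + t • d)) (inner ℝ (gradient F (z + t • d)) d) t := by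
      have := (hF.1 (z + t • d)).hasGradientAt.hasFDerivAt.comp_hasDerivAt t h1
      rw [InnerProductSpace.toDual_apply_apply] at this
      exact this
    have h3 : HasDerivAt (fun t : ℝ => t * inner ℝ (gradient F z) d) (inner ℝ (gradient F z) d) t := by
      simpa using (hasDerivAt_id t).mul_const (inner ℝ (gradient F z) d)
    have h4 : HasDerivAt (fun t : ℝ => ℓ / 2 * t ^ 2 * ‖d‖ ^ 2) (ℓ * t * ‖d‖ ^ 2) t := by
      have := ((hasDerivAt_pow 2 t).const_mul (ℓ / 2)).mul_const (‖d‖ ^ 2)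
      exact this.congr_deriv (by push_cast; ring)
    exact (h2.sub h3).sub h4
  have hanti : AntitoneOn ψ (Set.Icc 0 1) := by
    apply antitoneOn_of_deriv_nonpos (convex_Icc 0 1)
    · exact fun t _ => (hderiv t).continuousAt.continuousWithinAt
    · exact fun t _ => (hderiv t).differentiableAt.differentiableWithinAt
    · intro t ht
      rw [interior_Icc] at ht
      rw [(hderiv t).deriv, ← inner_sub_left]
      have h1 := real_inner_le_norm (gradient F (z + t • d) - gradient F z) d
      have h2 := hF.2 (z + t • d) z
      rw [add_sub_cancel_left, norm_smul, Real.norm_of_nonneg ht.1.le] at h2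
      have h3 := mul_le_mul_of_nonneg_right h2 (norm_nonneg d)
      nlinarith
  have h := hanti (Set.left_mem_Icc.2 zero_le_one) (Set.right_mem_Icc.2 zero_le_one) zero_le_one
  simp only [ψ, one_smul, zero_smul, add_zero] at h
  have hw : z + d = w := by rw [hd]; abel
  rw [hw] at h
  linarith

theorem IsSmooth.continuous (hF : IsSmooth ℓ F) : Continuous F := hF.1.continuous

theorem IsSmooth.continuous_gradient (hF : IsSmooth ℓ F) : Continuous (gradient F) := by
  have h : LipschitzWith (Real.toNNReal ℓ) (gradient F) :=
    LipschitzWith.of_dist_le_mul fun z w => by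
      rw [dist_eq_norm, dist_eq_norm]
      exact (hF.2 z w).trans
        (mul_le_mul_of_nonneg_right (Real.le_coe_toNNReal ℓ) (norm_nonneg _))
  exact h.continuous

theorem IsSmooth.neg (hF : IsSmooth ℓ F) : IsSmooth ℓ (fun z => -F z) := by
  have hg : ∀ z, gradient (fun z => -F z) z = -gradient F z := by
    intro z
    simp [gradient, fderiv_fun_neg]
  refine ⟨hF.1.neg, fun z z' => ?_⟩
  rw [hg, hg, neg_sub_neg, norm_sub_rev]
  exact hF.2 z z'

theorem IsSmooth.quadratic_le (hF : IsSmooth ℓ F) (z w : E) :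
    F z + inner ℝ (gradient F z) (w - z) - ℓ / 2 * ‖w - z‖ ^ 2 ≤ F w := by
  have h := hF.neg.le_quadratic z w
  have hg : gradient (fun z => -F z) z = -gradient F z := by
    simp [gradient, fderiv_fun_neg]
  rw [hg, inner_neg_left] at h
  linarith

end Smooth

/-! ### Partial gradients -/

section Partial

variable {m n : ℕ} {f : Vec m → Vec n → ℝ} {Y : Set (Vec n)} {ℓ L D : ℝ}

theorem inner_mkPair_zero_right (v : VecPair m n) (x : Vec m) :
    inner ℝ v (mkPair x 0) = inner ℝ v.fst x := by
  simp [WithLp.prod_inner_apply, mkPair]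

theorem inner_mkPair_zero_left (v : VecPair m n) (y : Vec n) :
    inner ℝ v (mkPair 0 y) = inner ℝ v.snd y := by
  simp [WithLp.prod_inner_apply, mkPair]

theorem norm_mkPair_zero_right (x : Vec m) : ‖(mkPair x 0 : VecPair m n)‖ = ‖x‖ := by
  simp [mkPair]

theorem norm_mkPair_zero_left (y : Vec n) : ‖(mkPair 0 y : VecPair m n)‖ = ‖y‖ := by
  simp [mkPair]

theorem mkPair_sub_mkPair_left (x x' : Vec m) (y : Vec n) :
    mkPair x' y - mkPair x y = mkPair (x' - x) 0 := by
  simp [mkPair, ← WithLp.toLp_sub]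

theorem mkPair_sub_mkPair_right (x : Vec m) (y y' : Vec n) :
    mkPair x y' - mkPair x y = mkPair 0 (y' - y) := by
  simp [mkPair, ← WithLp.toLp_sub]

theorem norm_fst_le (v : VecPair m n) : ‖v.fst‖ ≤ ‖v‖ := by
  have := WithLp.prod_norm_sq_eq_of_L2 v
  exact abs_le_of_sq_le_sq' (by nlinarith [sq_nonneg ‖v.snd‖]) (norm_nonneg v) |>.2

theorem norm_snd_le (v : VecPair m n) : ‖v.snd‖ ≤ ‖v‖ := by
  have := WithLp.prod_norm_sq_eq_of_L2 v
  exact abs_le_of_sq_le_sq' (by nlinarith [sq_nonneg ‖v.fst‖]) (norm_nonneg v) |>.2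

theorem continuous_mkPair : Continuous fun p : Vec m × Vec n => mkPair p.1 p.2 :=
  WithLp.prod_continuous_toLp 2 _ _

theorem continuous_uncurry_of_isSmooth (hf : IsSmooth ℓ (joint f)) :
    Continuous fun p : Vec m × Vec n => f p.1 p.2 :=
  hf.continuous.comp continuous_mkPair

theorem continuous_grad_of_isSmooth (hf : IsSmooth ℓ (joint f)) :
    Continuous fun p : Vec m × Vec n => grad f p.1 p.2 :=
  hf.continuous_gradient.comp continuous_mkPair

theorem quadratic_le_fst (hf : IsSmooth ℓ (joint f)) (x x' : Vec m) (y : Vec n) :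
    f x y + inner ℝ (grad f x y).fst (x' - x) - ℓ / 2 * ‖x' - x‖ ^ 2 ≤ f x' y := by
  have h := hf.quadratic_le (mkPair x y) (mkPair x' y)
  rwa [mkPair_sub_mkPair_left, norm_mkPair_zero_right, inner_mkPair_zero_right] at h

theorem quadratic_le_snd (hf : IsSmooth ℓ (joint f)) (x : Vec m) (y y' : Vec n) :
    f x y + inner ℝ (grad f x y).snd (y' - y) - ℓ / 2 * ‖y' - y‖ ^ 2 ≤ f x y' := by
  have h := hf.quadratic_le (mkPair x y) (mkPair x y')
  rwa [mkPair_sub_mkPair_right, norm_mkPair_zero_left, inner_mkPair_zero_left] at h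

theorem le_quadratic_snd (hf : IsSmooth ℓ (joint f)) (x : Vec m) (y y' : Vec n) :
    f x y' ≤ f x y + inner ℝ (grad f x y).snd (y' - y) + ℓ / 2 * ‖y' - y‖ ^ 2 := by
  have h := hf.le_quadratic (mkPair x y) (mkPair x y')
  rwa [mkPair_sub_mkPair_right, norm_mkPair_zero_left, inner_mkPair_zero_left] at h

/-! ### Gradient inequalities and the maximum function -/

namespace SmoothNonconvexConcave

variable (h : SmoothNonconvexConcave f Y ℓ L D)
include h

/-- Concavity is known only on `Y`, while the gradient is taken in the whole space. Concavity on the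
segment is compared with the quadratic upper bound, divided by `t`, and `t → 0`. -/
theorem le_add_inner_snd (x : Vec m) {y y' : Vec n} (hy : y ∈ Y) (hy' : y' ∈ Y) :
    f x y' ≤ f x y + inner ℝ (grad f x y).snd (y' - y) := by
  apply le_of_forall_le_add_mul (c := ℓ / 2 * ‖y' - y‖ ^ 2)
  intro t ht ht1
  have h1 := (h.concave x).2 hy hy' (sub_nonneg.2 ht1) ht.le (by ring)
  have h2 := le_quadratic_snd h.smooth x y ((1 - t) • y + t • y')
  have h3 : (1 - t) • y + t • y' - y = t • (y' - y) := by
    rw [sub_smul, one_smul, smul_sub]; abel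
  rw [h3, inner_smul_right, norm_smul, Real.norm_of_nonneg ht.le] at h2
  simp only [smul_eq_mul] at h1
  have h4 : t * (f x y') ≤ t * (f x y + inner ℝ (grad f x y).snd (y' - y) +
      t * (ℓ / 2 * ‖y' - y‖ ^ 2)) := by nlinarith
  exact le_of_mul_le_mul_left h4 ht

/-- A move of `t` times the partial gradient `v` raises `f` by `t ‖v‖²` to first order, while the
Lipschitz condition allows at most `t L ‖v‖`. -/
theorem norm_grad_fst_le (x : Vec m) {y : Vec n} (hy : y ∈ Y) : ‖(grad f x y).fst‖ ≤ L := by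
  set v := (grad f x y).fst with hv
  have key : ‖v‖ ^ 2 ≤ L * ‖v‖ := by
    apply le_of_forall_le_add_mul (c := ℓ / 2 * ‖v‖ ^ 2)
    intro t ht _
    have h1 := quadratic_le_fst h.smooth x (x + t • v) y
    have h2 := (le_abs_self _).trans (h.lipschitz y hy (x + t • v) x)
    rw [add_sub_cancel_left, norm_smul, Real.norm_of_nonneg ht.le] at h2
    rw [add_sub_cancel_left, inner_smul_right, ← hv, real_inner_self_eq_norm_sq, norm_smul,
      Real.norm_of_nonneg ht.le] at h1
    have h4 : t * ‖v‖ ^ 2 ≤ t * (L * ‖v‖ + t * (ℓ / 2 * ‖v‖ ^ 2)) := by nlinarith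
    exact le_of_mul_le_mul_left h4 ht
  rcases (norm_nonneg v).eq_or_lt with h0 | h0
  · rw [← h0]; exact h.L_pos.le
  · rw [sq] at key
    exact le_of_mul_le_mul_right key h0

theorem continuous_uncurry : Continuous fun p : Vec m × Vec n => f p.1 p.2 :=
  continuous_uncurry_of_isSmooth h.smooth

theorem continuous_right (x : Vec m) : Continuous (f x) :=
  h.continuous_uncurry.comp (Continuous.prodMk_right x)

theorem isCompact : IsCompact Y := Metric.isCompact_of_isClosed_isBounded h.closed h.bounded

theorem nonempty : Y.Nonempty := by
  rw [Set.nonempty_iff_ne_empty]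
  rintro rfl
  have := h.diam
  rw [Metric.diam_empty] at this
  exact h.D_pos.ne this

theorem norm_sub_le {y z : Vec n} (hy : y ∈ Y) (hz : z ∈ Y) : ‖y - z‖ ≤ D := by
  rw [← dist_eq_norm, ← h.diam]
  exact Metric.dist_le_diam_of_mem h.bounded hy hz

theorem le_maxFun (x : Vec m) {y : Vec n} (hy : y ∈ Y) : f x y ≤ maxFun f Y x :=
  (maxFun_isGreatest f Y x (h.continuous_right x) h.isCompact h.nonempty).2 ⟨y, hy, rfl⟩

theorem exists_eq_maxFun (x : Vec m) : ∃ y ∈ Y, f x y = maxFun f Y x :=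
  (maxFun_isGreatest f Y x (h.continuous_right x) h.isCompact h.nonempty).1

theorem maxFun_le_add (x x' : Vec m) : maxFun f Y x ≤ maxFun f Y x' + L * ‖x - x'‖ := by
  obtain ⟨y, hy, hxy⟩ := h.exists_eq_maxFun x
  have h1 := (le_abs_self _).trans (h.lipschitz y hy x x')
  have h2 := h.le_maxFun x' hy
  linarith

theorem continuous_maxFun : Continuous (maxFun f Y) := by
  have : LipschitzWith (Real.toNNReal L) (maxFun f Y) := by
    refine LipschitzWith.of_le_add_mul _ fun x x' => ?_
    rw [Real.coe_toNNReal _ h.L_pos.le, dist_eq_norm]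
    exact h.maxFun_le_add x x'
  exact this.continuous

/-- `Φ` is `ℓ`-weakly convex, as a supremum of `ℓ`-weakly convex functions. -/
theorem isWeaklyConvex : IsWeaklyConvex ℓ (maxFun f Y) := by
  refine ⟨convex_univ, fun a _ b _ s t hs ht hst => ?_⟩
  simp only [smul_eq_mul]
  set z := s • a + t • b with hz
  -- For `y` optimal at `z`, the quadratic lower bound of `f(·, y)` touches `Φ` at `z`. Adding `ℓ /
  -- 2 ‖·‖²` makes it an affine support, and the linear parts cancel because `z` is the barycentre
  -- of `a` and `b`.
  obtain ⟨y, hy, hxy⟩ := h.exists_eq_maxFun z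
  set v := (grad f z y).fst
  have ha := (quadratic_le_fst h.smooth z a y).trans (h.le_maxFun a hy)
  have hb := (quadratic_le_fst h.smooth z b y).trans (h.le_maxFun b hy)
  rw [hxy] at ha hb
  have expand : ∀ w : Vec m, ℓ / 2 * ‖w - z‖ ^ 2 =
      ℓ / 2 * ‖w‖ ^ 2 - ℓ / 2 * ‖z‖ ^ 2 - ℓ * inner ℝ z (w - z) := by
    intro w
    rw [norm_sub_sq_real, inner_sub_right, real_inner_self_eq_norm_sq, real_inner_comm]
    ring
  rw [expand] at ha hb
  have hzero : ∀ u : Vec m, s * inner ℝ u (a - z) + t * inner ℝ u (b - z) = 0 := by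
    intro u
    rw [← inner_smul_right, ← inner_smul_right, ← inner_add_right]
    have : s • (a - z) + t • (b - z) = 0 := by
      rw [smul_sub, smul_sub, sub_add_sub_comm, ← hz, ← add_smul, hst, one_smul, sub_self]
    rw [this, inner_zero_right]
  have hv := hzero v
  have hzz := hzero z
  have h1 := mul_le_mul_of_nonneg_left ha hs
  have h2 := mul_le_mul_of_nonneg_left hb ht
  have h3 : s * (maxFun f Y z + ℓ / 2 * ‖z‖ ^ 2) + t * (maxFun f Y z + ℓ / 2 * ‖z‖ ^ 2) =
    maxFun f Y z + ℓ / 2 * ‖z‖ ^ 2 := by rw [← add_mul, hst, one_mul]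
  linear_combination h1 + h2 - h3 - hv - ℓ * hzz

end SmoothNonconvexConcave

end Partial

/-! ### The Moreau envelope of a weakly convex function -/

section Moreau

variable {E : Type*} [NormedAddCommGroup E] [InnerProductSpace ℝ E] {ρ : ℝ} {φ : E → ℝ}

/-- `p` is the proximal point of `x`: the minimizer of the `ρ`-strongly convex function
`φ + ρ‖· - x‖²`. -/
def IsProx (ρ : ℝ) (φ : E → ℝ) (x p : E) : Prop :=
  ∀ w, φ p + ρ * ‖p - x‖ ^ 2 + ρ / 2 * ‖w - p‖ ^ 2 ≤ φ w + ρ * ‖w - x‖ ^ 2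

/-- Minimality is tested at `p + t (w - p)`; the strong convexity left after adding `ρ‖· - x‖²`
gives the growth term once one divides by `t` and lets `t → 0`. -/
theorem IsWeaklyConvex.isProx_of_minimizer (hφ : IsWeaklyConvex ρ φ) {x p : E}
    (hp : ∀ w, φ p + ρ * ‖p - x‖ ^ 2 ≤ φ w + ρ * ‖w - x‖ ^ 2) : IsProx ρ φ x p := by
  intro w
  apply le_of_forall_le_add_mul (c := ρ / 2 * ‖w - p‖ ^ 2)
  intro t ht ht1
  have h1 := hφ.2 (Set.mem_univ p) (Set.mem_univ w) (sub_nonneg.2 ht1) ht.le (by ring)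
  have h2 := hp ((1 - t) • p + t • w)
  simp only [smul_eq_mul] at h1
  have e1 : (1 - t) • p + t • w = p + t • (w - p) := by
    rw [sub_smul, one_smul, smul_sub]; abel
  have e2 : p + t • (w - p) - x = (p - x) + t • (w - p) := by abel
  have e3 : w = p + (w - p) := by abel
  have e4 : w - x = (p - x) + (w - p) := by abel
  rw [e1] at h1 h2
  rw [e2, norm_add_sq_real, inner_smul_right, norm_smul, Real.norm_of_nonneg ht.le] at h2
  have h3 : ‖w‖ ^ 2 = ‖p‖ ^ 2 + 2 * inner ℝ p (w - p) + ‖w - p‖ ^ 2 := by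
    rw [← norm_add_sq_real, ← e3]
  rw [h3, norm_add_sq_real p, inner_smul_right, norm_smul, Real.norm_of_nonneg ht.le] at h1
  rw [e4, norm_add_sq_real]
  have h4 : t * (φ p + ρ * ‖p - x‖ ^ 2 + ρ / 2 * ‖w - p‖ ^ 2) ≤
      t * (φ w + ρ * (‖p - x‖ ^ 2 + 2 * inner ℝ (p - x) (w - p) + ‖w - p‖ ^ 2) +
        t * (ρ / 2 * ‖w - p‖ ^ 2)) := by
    linear_combination h1 + h2
  exact le_of_mul_le_mul_left h4 ht

theorem IsWeaklyConvex.exists_isProx [ProperSpace E] (hφ : IsWeaklyConvex ρ φ) (hρ : 0 < ρ)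
    (hc : Continuous φ) (hb : BddBelow (Set.range φ)) (x : E) : ∃ p, IsProx ρ φ x p := by
  obtain ⟨b, hb⟩ := hb
  have hb' : ∀ w, b ≤ φ w := fun w => hb ⟨w, rfl⟩
  have hcont : Continuous fun w => φ w + ρ * ‖w - x‖ ^ 2 := by fun_prop
  obtain ⟨p, hp⟩ := hcont.exists_forall_le' x (by
    -- Outside this ball the penalty alone exceeds `φ x - b`, so `w` is worse than `x` itself.
    filter_upwards [(isCompact_closedBall x (√((φ x - b) / ρ))).compl_mem_cocompact] with w hw
    rw [Set.mem_compl_iff, Metric.mem_closedBall, not_le, dist_eq_norm] at hw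
    have h1 := Real.lt_sq_of_sqrt_lt hw
    rw [div_lt_iff₀ hρ] at h1
    have := hb' w
    simp only [sub_self, norm_zero]
    linarith)
  exact ⟨p, hφ.isProx_of_minimizer hp⟩

variable {p : E → E} (hp : ∀ x, IsProx ρ φ x (p x)) (hρ : 0 < ρ)
include hp hρ

omit [InnerProductSpace ℝ E] in
theorem moreauEnvelope_eq (x : E) :
    moreauEnvelope φ (1 / (2 * ρ)) x = φ (p x) + ρ * ‖p x - x‖ ^ 2 := by
  have e : 1 / (2 * (1 / (2 * ρ))) = ρ := by field_simp
  unfold moreauEnvelope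
  rw [e]
  have hle : ∀ w, φ (p x) + ρ * ‖p x - x‖ ^ 2 ≤ φ w + ρ * ‖w - x‖ ^ 2 := fun w => by
    have := hp x w
    have : 0 ≤ ρ / 2 * ‖w - p x‖ ^ 2 := by positivity
    linarith
  exact le_antisymm (ciInf_le ⟨_, by rintro _ ⟨w, rfl⟩; exact hle w⟩ (p x)) (le_ciInf hle)

omit [InnerProductSpace ℝ E] in
theorem moreauEnvelope_le (x w : E) :
    moreauEnvelope φ (1 / (2 * ρ)) x ≤ φ w + ρ * ‖w - x‖ ^ 2 := by
  rw [moreauEnvelope_eq hp hρ]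
  have := hp x w
  have : 0 ≤ ρ / 2 * ‖w - p x‖ ^ 2 := by positivity
  linarith

omit [InnerProductSpace ℝ E] in
theorem moreauEnvelope_le_self (x : E) : moreauEnvelope φ (1 / (2 * ρ)) x ≤ φ x := by
  simpa using moreauEnvelope_le hp hρ x x

omit [InnerProductSpace ℝ E] in
theorem iInf_le_moreauEnvelope (hb : BddBelow (Set.range φ)) (x : E) :
    ⨅ w, φ w ≤ moreauEnvelope φ (1 / (2 * ρ)) x := by
  rw [moreauEnvelope_eq hp hρ]
  have := ciInf_le hb (p x)
  have : 0 ≤ ρ * ‖p x - x‖ ^ 2 := by positivity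
  linarith

/-- Testing each proximal point against the other and adding gives `ρ‖p x' - p x‖² ≤ 2ρ⟨p x' - p x,
x' - x⟩`. -/
theorem norm_prox_sub_prox_le (x x' : E) : ‖p x' - p x‖ ≤ 2 * ‖x' - x‖ := by
  have h1 := hp x (p x')
  have h2 := hp x' (p x)
  have e1 : p x' - x = (p x' - x') + (x' - x) := by abel
  have e2 : p x - x' = (p x - x) - (x' - x) := by abel
  rw [e1, norm_add_sq_real] at h1
  rw [e2, norm_sub_sq_real (p x - x), norm_sub_rev (p x) (p x')] at h2
  have e3 : inner ℝ (p x' - p x) (x' - x) =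
      inner ℝ (p x' - x') (x' - x) - inner ℝ (p x - x) (x' - x) + ‖x' - x‖ ^ 2 := by
    rw [← real_inner_self_eq_norm_sq, ← inner_sub_left, ← inner_add_left]
    congr 1; abel
  have h3 := real_inner_le_norm (p x' - p x) (x' - x)
  have h4 : ρ * ‖p x' - p x‖ ^ 2 ≤ ρ * (2 * ‖x' - x‖ * ‖p x' - p x‖) := by
    nlinarith
  have h5 := le_of_mul_le_mul_left h4 hρ
  rcases (norm_nonneg (p x' - p x)).eq_or_lt with h0 | h0
  · rw [← h0]; positivity
  · rw [sq] at h5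
    exact le_of_mul_le_mul_right h5 h0

theorem continuous_prox : Continuous p :=
  (LipschitzWith.of_dist_le_mul (K := 2) fun x x' => by
    rw [dist_eq_norm, dist_eq_norm]
    exact norm_prox_sub_prox_le hp hρ x' x).continuous

/-- The competitor `p x` at `x'` bounds the increment of the envelope from above, and `p x'` at `x`
bounds it from below. Since `p` is Lipschitz, both agree with the linear term up to `O(‖x' - x‖²)`.
-/
theorem hasGradientAt_moreauEnvelope [CompleteSpace E] (x : E) :
    HasGradientAt (moreauEnvelope φ (1 / (2 * ρ))) ((2 * ρ) • (x - p x)) x := by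
  rw [hasGradientAt_iff_isLittleO]
  have hO : (fun x' => moreauEnvelope φ (1 / (2 * ρ)) x' - moreauEnvelope φ (1 / (2 * ρ)) x -
      inner ℝ ((2 * ρ) • (x - p x)) (x' - x)) =O[nhds x] fun x' => ‖x' - x‖ ^ 2 := by
    refine Asymptotics.IsBigO.of_bound (5 * ρ) (Filter.Eventually.of_forall fun x' => ?_)
    have h1 := moreauEnvelope_le hp hρ x' (p x)
    have h2 := moreauEnvelope_le hp hρ x (p x')
    rw [Real.norm_of_nonneg (sq_nonneg _), Real.norm_eq_abs, abs_le, inner_smul_left]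
    rw [moreauEnvelope_eq hp hρ x'] at h1 ⊢
    rw [moreauEnvelope_eq hp hρ x] at h2 ⊢
    have e1 : p x - x' = (p x - x) - (x' - x) := by abel
    have e2 : p x' - x = (p x' - x') + (x' - x) := by abel
    have e3 : inner ℝ (p x' - x') (x' - x) =
        inner ℝ (p x' - p x) (x' - x) + inner ℝ (p x - x) (x' - x) - ‖x' - x‖ ^ 2 := by
      rw [← real_inner_self_eq_norm_sq, ← inner_add_left, ← inner_sub_left]
      congr 1; abel
    have e4 : inner ℝ (x - p x) (x' - x) = - inner ℝ (p x - x) (x' - x) := by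
      rw [← inner_neg_left, neg_sub]
    have h3 := (real_inner_le_norm (p x' - p x) (x' - x)).trans
      (mul_le_mul_of_nonneg_right (norm_prox_sub_prox_le hp hρ x x') (norm_nonneg _))
    have h4 := mul_le_mul_of_nonneg_left h3 hρ.le
    have h5 : 0 ≤ ρ * ‖x' - x‖ ^ 2 := by positivity
    rw [e1, norm_sub_sq_real (p x - x)] at h1
    rw [e2, norm_add_sq_real, e3] at h2
    rw [e4]
    simp only [conj_trivial]
    constructor
    · linear_combination h2 + 2 * h4 + 2 * h5
    · linear_combination h1 + 4 * h5
  refine hO.trans_isLittleO ?_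
  have h := (Asymptotics.isLittleO_norm_pow_id (E' := E) one_lt_two).comp_tendsto
    (show Filter.Tendsto (fun x' => x' - x) (nhds x) (nhds 0) from
      tendsto_sub_nhds_zero_iff.2 Filter.tendsto_id)
  exact h

theorem gradient_moreauEnvelope [CompleteSpace E] (x : E) :
    gradient (moreauEnvelope φ (1 / (2 * ρ))) x = (2 * ρ) • (x - p x) :=
  (hasGradientAt_moreauEnvelope hp hρ x).gradient

theorem norm_gradient_moreauEnvelope_sq [CompleteSpace E] (x : E) :
    ‖gradient (moreauEnvelope φ (1 / (2 * ρ))) x‖ ^ 2 = 4 * ρ ^ 2 * ‖p x - x‖ ^ 2 := by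
  rw [gradient_moreauEnvelope hp hρ, norm_smul, norm_sub_rev, Real.norm_of_nonneg (by positivity)]
  ring

theorem differentiable_moreauEnvelope [CompleteSpace E] :
    Differentiable ℝ (moreauEnvelope φ (1 / (2 * ρ))) :=
  fun x => (hasGradientAt_moreauEnvelope hp hρ x).differentiableAt

omit [InnerProductSpace ℝ E] in
-- Moving from `x` to `p x` saves at least `ρ‖p x - x‖²` in `φ`, but at most `L‖p x - x‖`. The bound
-- makes the envelope gradient bounded, and `p x - x` an admissible test vector for the noise.
theorem norm_prox_sub_le {L : ℝ} (hL0 : 0 ≤ L)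
    (hL : ∀ x x', φ x ≤ φ x' + L * ‖x - x'‖) (x : E) :
    ‖p x - x‖ ≤ L / ρ := by
  have h1 := hp x x
  have h2 := hL x (p x)
  rw [sub_self, norm_zero, norm_sub_rev x (p x)] at h1
  rw [norm_sub_rev x (p x)] at h2
  have h3 : 0 ≤ ρ / 2 * ‖p x - x‖ ^ 2 := by positivity
  rw [le_div_iff₀ hρ]
  rcases (norm_nonneg (p x - x)).eq_or_lt with h0 | h0
  · rwa [← h0, zero_mul]
  · have : ‖p x - x‖ * (‖p x - x‖ * ρ) ≤ ‖p x - x‖ * L := by nlinarith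
    exact le_of_mul_le_mul_left this h0

end Moreau

/-! ### The projection onto a closed convex set -/

section Projection

variable {d : ℕ} {Y : Set (Vec d)}

/-- No point on the segment from the projection to `z` is nearer to `u`; the inequality is the
first-order term of this comparison. -/
theorem inner_sub_proj_le_zero (hY : IsClosed Y) (hne : Y.Nonempty) (hc : Convex ℝ Y) (u : Vec d)
    {z : Vec d} (hz : z ∈ Y) : inner ℝ (u - proj Y u) (z - proj Y u) ≤ 0 := by
  obtain ⟨hp, hmin⟩ := proj_spec Y hY hne u
  set p := proj Y u
  apply le_of_forall_le_add_mul (c := ‖z - p‖ ^ 2 / 2)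
  intro t ht ht1
  have hmem : (1 - t) • p + t • z ∈ Y := hc hp hz (sub_nonneg.2 ht1) ht.le (by ring)
  have h1 := hmin _ hmem
  have e1 : u - ((1 - t) • p + t • z) = (u - p) - t • (z - p) := by
    rw [sub_smul, one_smul, smul_sub]; abel
  rw [e1] at h1
  have h2 := pow_le_pow_left₀ (norm_nonneg _) h1 2
  rw [norm_sub_sq_real (u - p) (t • (z - p)), inner_smul_right, norm_smul,
    Real.norm_of_nonneg ht.le] at h2
  have h3 : t * inner ℝ (u - p) (z - p) ≤ t * (0 + t * (‖z - p‖ ^ 2 / 2)) := by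
    linear_combination h2 / 2
  exact le_of_mul_le_mul_left h3 ht

/-- Adding the two variational inequalities gives firm nonexpansiveness. The resulting continuity
makes the random iterates measurable. -/
theorem norm_proj_sub_proj_le (hY : IsClosed Y) (hne : Y.Nonempty) (hc : Convex ℝ Y)
    (u v : Vec d) : ‖proj Y u - proj Y v‖ ≤ ‖u - v‖ := by
  have h1 := inner_sub_proj_le_zero hY hne hc u (proj_spec Y hY hne v).1
  have h2 := inner_sub_proj_le_zero hY hne hc v (proj_spec Y hY hne u).1
  have h3 : ‖proj Y u - proj Y v‖ ^ 2 ≤ inner ℝ (u - v) (proj Y u - proj Y v) := by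
    have e1 : u - v = (u - proj Y u) - (v - proj Y v) + (proj Y u - proj Y v) := by abel
    have e2 : proj Y v - proj Y u = -(proj Y u - proj Y v) := by abel
    rw [e2, inner_neg_right] at h1
    rw [e1, inner_add_left, inner_sub_left, real_inner_self_eq_norm_sq]
    linarith
  have h4 := h3.trans (real_inner_le_norm _ _)
  rcases (norm_nonneg (proj Y u - proj Y v)).eq_or_lt with h0 | h0
  · rw [← h0]; positivity
  · rw [sq] at h4
    exact le_of_mul_le_mul_right h4 h0

theorem continuous_proj (hY : IsClosed Y) (hne : Y.Nonempty) (hc : Convex ℝ Y) :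
    Continuous (proj Y) :=
  (LipschitzWith.of_dist_le_mul (K := 1) fun u v => by
    rw [dist_eq_norm, dist_eq_norm, NNReal.coe_one, one_mul]
    exact norm_proj_sub_proj_le hY hne hc u v).continuous

end Projection

/-! ### One step of descent and one step of ascent -/

namespace SmoothNonconvexConcave

variable {m n : ℕ} {f : Vec m → Vec n → ℝ} {Y : Set (Vec n)} {ℓ L D : ℝ}

section Steps

variable (h : SmoothNonconvexConcave f Y ℓ L D)
include h

/-- One projected ascent step with gradient estimate `g` decreases the distance to `z ∈ Y` in
proportion to the suboptimality, up to the noise `g - ∇_y f(x, y)`. -/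
theorem ascent_step (x : Vec m) {y z : Vec n} (hy : y ∈ Y) (hz : z ∈ Y) (g : Vec n) {η : ℝ}
    (hη : 0 < η) (hstep : η * ℓ ≤ 1 / 2 ∨ η * ℓ ≤ 1 ∧ g - (grad f x y).snd = 0) :
    f x z ≤ f x (proj Y (y + η • g)) +
      (‖z - y‖ ^ 2 - ‖z - proj Y (y + η • g)‖ ^ 2) / (2 * η) +
      η * ‖g - (grad f x y).snd‖ ^ 2 - inner ℝ (g - (grad f x y).snd) (z - y) := by
  have hvar := inner_sub_proj_le_zero h.closed h.nonempty h.convex (y + η • g) hz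
  have hp := (proj_spec Y h.closed h.nonempty (y + η • g)).1
  set p := proj Y (y + η • g)
  set e := g - (grad f x y).snd with he
  have h1 := h.le_add_inner_snd x hy hz
  have h2 := quadratic_le_snd h.smooth x y p
  have eg : (grad f x y).snd = g - e := by rw [he]; abel
  rw [eg] at h1 h2
  set d := p - y with hd
  set w := z - y with hw
  have e1 : y + η • g - p = η • g - d := by rw [hd]; abel
  have e2 : z - p = w - d := by rw [hd, hw]; abel
  clear_value d w
  rw [e1, e2, inner_sub_left, inner_sub_right, inner_sub_right, inner_smul_left, inner_smul_left,
    real_inner_self_eq_norm_sq] at hvar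
  simp only [conj_trivial] at hvar
  rw [e2, norm_sub_sq_real w d, real_inner_comm]
  rw [inner_sub_left] at h1 h2
  -- Young's inequality absorbs the noise into the slack `(1 - ηℓ)‖d‖²`, which needs `ηℓ ≤ 1/2`.
  -- Without noise a nonnegative slack suffices, hence the larger step `1/ℓ` of TTGDA.
  have h3 : 2 * η * inner ℝ e d ≤ 2 * η ^ 2 * ‖e‖ ^ 2 + (1 - η * ℓ) * ‖d‖ ^ 2 := by
    rcases hstep with hs | ⟨hs, he0⟩
    · have a := mul_le_mul_of_nonneg_left (real_inner_le_norm e d) hη.le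
      nlinarith [sq_nonneg (2 * η * ‖e‖ - ‖d‖), sq_nonneg ‖d‖]
    · rw [he0, inner_zero_left]
      have := mul_nonneg (sub_nonneg.2 hs) (sq_nonneg ‖d‖)
      simpa using this
  -- The remaining linear noise is paired with `w = z - y`, which does not involve the estimate `g`;
  -- only this pairing averages to zero.
  have h4 : 2 * η * (f x z - f x p - η * ‖e‖ ^ 2 + inner ℝ e w) ≤
      ‖w‖ ^ 2 - (‖w‖ ^ 2 - 2 * inner ℝ d w + ‖d‖ ^ 2) := by
    have h1' := mul_le_mul_of_nonneg_left h1 hη.le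
    have h2' := mul_le_mul_of_nonneg_left h2 hη.le
    linear_combination 2 * h1' + 2 * h2' + 2 * hvar + h3
  have h5 : f x z - f x p - η * ‖e‖ ^ 2 + inner ℝ e w ≤
      (‖w‖ ^ 2 - (‖w‖ ^ 2 - 2 * inner ℝ d w + ‖d‖ ^ 2)) / (2 * η) := by
    rw [le_div_iff₀ (by positivity)]
    linarith
  linarith

/-- The primal gap is bounded by the increase of the potential `f(x, y) - ‖z - y‖² / (2ηy)` along
one step of the algorithm. -/
theorem gap_le_potential_sub (x : Vec m) {y z : Vec n} (hy : y ∈ Y) (hz : z ∈ Y)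
    (g : VecPair m n) {ηx ηy : ℝ} (hηx : 0 ≤ ηx) (hηy : 0 < ηy)
    (hstep : ηy * ℓ ≤ 1 / 2 ∨ ηy * ℓ ≤ 1 ∧ g - grad f x y = 0) :
    maxFun f Y x - f x y ≤ (maxFun f Y x - f x z) +
      (f (x - ηx • g.fst) (proj Y (y + ηy • g.snd)) -
        ‖z - proj Y (y + ηy • g.snd)‖ ^ 2 / (2 * ηy)) -
      (f x y - ‖z - y‖ ^ 2 / (2 * ηy)) + ηy * ‖g - grad f x y‖ ^ 2 -
      inner ℝ (g - grad f x y) (mkPair 0 (z - y)) + ηx * (L * ‖g.fst‖) := by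
  have hsnd : g.snd - (grad f x y).snd = (g - grad f x y).snd := by simp
  have h1 := h.ascent_step x hy hz g.snd hηy
    (hstep.imp id fun hs => ⟨hs.1, by rw [hsnd, hs.2]; simp⟩)
  -- Replacing `x` by its successor in `f(·, y⁺)`, where `y⁺` is the new `y`, costs `ηx L‖g.fst‖`
  -- and lets the values of `f` telescope.
  have h2 := (le_abs_self _).trans (h.lipschitz _
    (proj_spec Y h.closed h.nonempty (y + ηy • g.snd)).1 x (x - ηx • g.fst))
  rw [sub_sub_cancel, norm_smul, Real.norm_of_nonneg hηx] at h2
  rw [inner_mkPair_zero_left]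
  rw [hsnd] at h1
  have h3 := mul_le_mul_of_nonneg_left
    (pow_le_pow_left₀ (norm_nonneg _) (norm_snd_le (g - grad f x y)) 2) hηy.le
  rw [sub_div] at h1
  linarith

/-- One gradient step, with gradient estimate `g`, on the Moreau envelope. -/
theorem descent_step {p : Vec m → Vec m} (hp : ∀ x, IsProx ℓ (maxFun f Y) x (p x))
    (x : Vec m) {y : Vec n} (hy : y ∈ Y) (g : VecPair m n) {η : ℝ} (hη : 0 ≤ η) :
    moreauEnvelope (maxFun f Y) (1 / (2 * ℓ)) (x - η • g.fst) ≤
      moreauEnvelope (maxFun f Y) (1 / (2 * ℓ)) x + 2 * η * ℓ * (maxFun f Y x - f x y) -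
      η / 2 * ‖gradient (moreauEnvelope (maxFun f Y) (1 / (2 * ℓ))) x‖ ^ 2 +
      2 * η * ℓ * inner ℝ (g - grad f x y) (mkPair (p x - x) 0) + η ^ 2 * ℓ * ‖g.fst‖ ^ 2 := by
  have hfst : (g - grad f x y).fst = g.fst - (grad f x y).fst := by simp
  have h1 := moreauEnvelope_le hp h.ell_pos (x - η • g.fst) (p x)
  have e1 : p x - (x - η • g.fst) = (p x - x) + η • g.fst := by abel
  rw [e1, norm_add_sq_real, inner_smul_right, norm_smul, Real.norm_of_nonneg hη] at h1
  have h2 := (quadratic_le_fst h.smooth x (p x) y).trans (h.le_maxFun (p x) hy)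
  have h3 := hp x x
  rw [sub_self, norm_zero, norm_sub_rev x (p x)] at h3
  rw [norm_gradient_moreauEnvelope_sq hp h.ell_pos, inner_mkPair_zero_right, hfst, inner_sub_left,
    moreauEnvelope_eq hp h.ell_pos x]
  rw [real_inner_comm] at h1
  -- The quadratic lower bound loses `ℓ/2 ‖p x - x‖²` and the proximal growth inequality gains `3ℓ/2
  -- ‖p x - x‖²`; the net `ℓ‖p x - x‖²` yields the negative gradient term.
  have h4 : inner ℝ (grad f x y).fst (p x - x) ≤
      maxFun f Y x - f x y - ℓ * ‖p x - x‖ ^ 2 := by linarith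
  have h5 := mul_le_mul_of_nonneg_left h4 (mul_nonneg hη h.ell_pos.le)
  linear_combination h1 + 2 * h5

/-- The cross term is kept instead of estimated: its mean vanishes, so the second moment is `L² +
σ²` with no extra factor. -/
theorem norm_fst_sq_le (x : Vec m) {y : Vec n} (hy : y ∈ Y) (g : VecPair m n) :
    ‖g.fst‖ ^ 2 ≤ L ^ 2 + ‖g - grad f x y‖ ^ 2 +
      2 * inner ℝ (g - grad f x y) (mkPair (grad f x y).fst 0) := by
  have hfst : (g - grad f x y).fst = g.fst - (grad f x y).fst := by simp
  have e : g.fst = (g - grad f x y).fst + (grad f x y).fst := by rw [hfst]; abel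
  rw [inner_mkPair_zero_right, e, norm_add_sq_real]
  have h1 := pow_le_pow_left₀ (norm_nonneg _) (norm_fst_le (g - grad f x y)) 2
  have h2 := pow_le_pow_left₀ (norm_nonneg _) (h.norm_grad_fst_le x hy) 2
  linarith

/-- Linear growth in `x`, uniform over `Y`, makes `f` and `Φ` integrable along the iterates. -/
theorem exists_abs_le : ∃ C, ∀ x, ∀ y ∈ Y, |f x y| ≤ C + L * ‖x‖ := by
  obtain ⟨C, hC⟩ := (h.isCompact.image (h.continuous_right 0)).isBounded.exists_norm_le
  refine ⟨C, fun x y hy => ?_⟩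
  have h1 := h.lipschitz y hy x 0
  have h2 := hC _ ⟨y, hy, rfl⟩
  rw [sub_zero] at h1
  rw [Real.norm_eq_abs] at h2
  have := abs_sub_abs_le_abs_sub (f x y) (f 0 y)
  linarith

end Steps

end SmoothNonconvexConcave

/-! ### Gradient descent ascent with noisy gradients -/

theorem integrable_fun_sub {α E : Type*} [MeasurableSpace α] [NormedAddCommGroup E]
    {μ : Measure α} {f g : α → E}
    (hf : Integrable f μ) (hg : Integrable g μ) : Integrable (fun a => f a - g a) μ :=
  hf.sub hg

/-- The error of the gradient estimates `g t` along the iterates `(x t, y t)`. -/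
def noise {m n : ℕ} {Ω : Type*} (f : Vec m → Vec n → ℝ) (x : ℕ → Ω → Vec m)
    (y : ℕ → Ω → Vec n) (g : ℕ → Ω → VecPair m n) (t : ℕ) (ω : Ω) : VecPair m n :=
  g t ω - grad f (x t ω) (y t ω)

/-- The iterates `(x t, y t)` of projected gradient descent ascent driven by gradient estimates
`g t` whose errors are conditionally centered given the past `ℱ t` and have variance at most
`σ²`. -/
structure IsNoisyRun {m n : ℕ} {Ω : Type*} {mΩ : MeasurableSpace Ω} (f : Vec m → Vec n → ℝ)
    (Y : Set (Vec n)) (ηx ηy σ : ℝ) (x₀ : Vec m) (y₀ : Vec n) (P : Measure Ω)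
    (ℱ : Filtration ℕ mΩ) (x : ℕ → Ω → Vec m) (y : ℕ → Ω → Vec n)
    (g : ℕ → Ω → VecPair m n) : Prop where
  x_zero : ∀ ω, x 0 ω = x₀
  y_zero : ∀ ω, y 0 ω = y₀
  x_succ : ∀ t ω, x (t + 1) ω = x t ω - ηx • (g t ω).fst
  y_succ : ∀ t ω, y (t + 1) ω = proj Y (y t ω + ηy • (g t ω).snd)
  x_measurable : ∀ t, Measurable[ℱ t] (x t)
  y_measurable : ∀ t, Measurable[ℱ t] (y t)
  noise_memLp : ∀ t, MemLp (noise f x y g t) 2 P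
  noise_variance : ∀ t, ∫ ω, ‖noise f x y g t ω‖ ^ 2 ∂P ≤ σ ^ 2
  noise_orthogonal : ∀ t (W : Ω → VecPair m n) (C : ℝ), Measurable[ℱ t] W →
    (∀ ω, ‖W ω‖ ≤ C) → ∫ ω, inner ℝ (noise f x y g t ω) (W ω) ∂P = 0

namespace IsNoisyRun

variable {m n : ℕ} {f : Vec m → Vec n → ℝ} {Y : Set (Vec n)} {ℓ L D ηx ηy σ : ℝ}
  {x₀ : Vec m} {y₀ : Vec n} {Ω : Type*} {mΩ : MeasurableSpace Ω} {P : Measure Ω}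
  [IsProbabilityMeasure P] {ℱ : Filtration ℕ mΩ} {x : ℕ → Ω → Vec m} {y : ℕ → Ω → Vec n}
  {g : ℕ → Ω → VecPair m n}
  (r : IsNoisyRun f Y ηx ηy σ x₀ y₀ P ℱ x y g) (h : SmoothNonconvexConcave f Y ℓ L D)

include r in
omit [IsProbabilityMeasure P] in
theorem measurable_x (t : ℕ) : Measurable (x t) := (r.x_measurable t).mono (ℱ.le t) le_rfl

include r in
omit [IsProbabilityMeasure P] in
theorem measurable_y (t : ℕ) : Measurable (y t) := (r.y_measurable t).mono (ℱ.le t) le_rfl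

include r h

omit [IsProbabilityMeasure P] in
theorem y_mem (hy₀ : y₀ ∈ Y) (t : ℕ) (ω : Ω) : y t ω ∈ Y := by
  cases t with
  | zero => rw [r.y_zero]; exact hy₀
  | succ t => rw [r.y_succ]; exact (proj_spec Y h.closed h.nonempty _).1

omit [IsProbabilityMeasure P] in
theorem measurable_grad (t : ℕ) :
    Measurable[ℱ t] fun ω => grad f (x t ω) (y t ω) :=
  (continuous_grad_of_isSmooth h.smooth).measurable.comp
    ((r.x_measurable t).prodMk (r.y_measurable t))

theorem memLp_grad_fst (hy₀ : y₀ ∈ Y) (t : ℕ) :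
    MemLp (fun ω => (grad f (x t ω) (y t ω)).fst) 2 P :=
  MemLp.of_bound ((WithLp.continuous_fst 2 _ _).measurable.comp
      ((r.measurable_grad h t).mono (ℱ.le t) le_rfl)).aestronglyMeasurable L
    (Filter.Eventually.of_forall fun ω => h.norm_grad_fst_le _ (r.y_mem h hy₀ t ω))

theorem memLp_g_fst (hy₀ : y₀ ∈ Y) (t : ℕ) : MemLp (fun ω => (g t ω).fst) 2 P := by
  have h1 : MemLp (fun ω => (noise f x y g t ω).fst) 2 P :=
    (r.noise_memLp t).mono ((WithLp.continuous_fst 2 _ _).comp_aestronglyMeasurable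
      (r.noise_memLp t).1) (Filter.Eventually.of_forall fun ω => norm_fst_le _)
  have h2 : (fun ω => (g t ω).fst) =
      (fun ω => (noise f x y g t ω).fst) + fun ω => (grad f (x t ω) (y t ω)).fst := by
    funext ω
    simp [noise]
  rw [h2]
  exact h1.add (r.memLp_grad_fst h hy₀ t)

theorem memLp_x (hy₀ : y₀ ∈ Y) (t : ℕ) : MemLp (x t) 2 P := by
  induction t with
  | zero =>
    have : x 0 = fun _ => x₀ := funext r.x_zero
    rw [this]; exact memLp_const _
  | succ t ih =>
    have : x (t + 1) = x t - ηx • fun ω => (g t ω).fst := funext fun ω => r.x_succ t ω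
    rw [this]; exact ih.sub ((r.memLp_g_fst h hy₀ t).const_smul ηx)

theorem integrable_norm_sub (hy₀ : y₀ ∈ Y) (s t : ℕ) :
    Integrable (fun ω => ‖x t ω - x s ω‖) P :=
  (((r.memLp_x h hy₀ t).sub (r.memLp_x h hy₀ s)).integrable one_le_two).norm

omit h in
theorem integrable_inner_noise (t : ℕ) {W : Ω → VecPair m n} {C : ℝ} (hW : Measurable W)
    (hC : ∀ ω, ‖W ω‖ ≤ C) : Integrable (fun ω => inner ℝ (noise f x y g t ω) (W ω)) P := by
  have h1 : Integrable (fun ω => ‖noise f x y g t ω‖ * C) P :=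
    ((r.noise_memLp t).integrable one_le_two).norm.mul_const C
  refine h1.mono' ((r.noise_memLp t).1.inner hW.aestronglyMeasurable)
    (Filter.Eventually.of_forall fun ω => (norm_inner_le_norm _ _).trans ?_)
  exact mul_le_mul_of_nonneg_left (hC ω) (norm_nonneg _)

omit h in
omit [IsProbabilityMeasure P] in
theorem integrable_noise_sq (t : ℕ) : Integrable (fun ω => ‖noise f x y g t ω‖ ^ 2) P :=
  (memLp_two_iff_integrable_sq_norm (r.noise_memLp t).1).1 (r.noise_memLp t)

theorem integral_norm_g_fst_sq_le (hy₀ : y₀ ∈ Y) (t : ℕ) :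
    ∫ ω, ‖(g t ω).fst‖ ^ 2 ∂P ≤ L ^ 2 + σ ^ 2 := by
  set W : Ω → VecPair m n := fun ω => mkPair (grad f (x t ω) (y t ω)).fst 0
  have hWm : Measurable[ℱ t] W := continuous_mkPair.measurable.comp
    (((WithLp.continuous_fst 2 _ _).measurable.comp (r.measurable_grad h t)).prodMk
      measurable_const)
  have hWb : ∀ ω, ‖W ω‖ ≤ L := fun ω => by
    rw [norm_mkPair_zero_right]
    exact h.norm_grad_fst_le _ (r.y_mem h hy₀ t ω)
  have hWi := r.integrable_inner_noise t (hWm.mono (ℱ.le t) le_rfl) hWb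
  have hn := r.integrable_noise_sq t
  have h1 : ∫ ω, ‖(g t ω).fst‖ ^ 2 ∂P ≤
      ∫ ω, (L ^ 2 + ‖noise f x y g t ω‖ ^ 2 + 2 * inner ℝ (noise f x y g t ω) (W ω)) ∂P := by
    refine integral_mono (memLp_two_iff_integrable_sq_norm (r.memLp_g_fst h hy₀ t).1 |>.1
      (r.memLp_g_fst h hy₀ t)) (((integrable_const _).fun_add hn).add (hWi.const_mul 2)) fun ω => ?_
    exact h.norm_fst_sq_le (x t ω) (r.y_mem h hy₀ t ω) (g t ω)
  rw [integral_add ((integrable_const _).fun_add hn) (hWi.const_mul 2),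
    integral_add (integrable_const _) hn, integral_const_mul, r.noise_orthogonal t W L hWm hWb] at h1
  have := r.noise_variance t
  simp only [integral_const, probReal_univ, one_smul] at h1
  linarith

/-- The arithmetic–geometric mean inequality expresses the drift of `x` in the same unit `L² + σ²`
as the second moment. -/
theorem integral_mul_norm_g_fst_le (hy₀ : y₀ ∈ Y) (t : ℕ) :
    ∫ ω, L * ‖(g t ω).fst‖ ∂P ≤ L ^ 2 + σ ^ 2 := by
  have hi := memLp_two_iff_integrable_sq_norm (r.memLp_g_fst h hy₀ t).1 |>.1
    (r.memLp_g_fst h hy₀ t)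
  have h1 : ∫ ω, L * ‖(g t ω).fst‖ ∂P ≤ ∫ ω, (L ^ 2 / 2 + ‖(g t ω).fst‖ ^ 2 / 2) ∂P := by
    refine integral_mono (((r.memLp_g_fst h hy₀ t).integrable one_le_two).norm.const_mul L)
      ((integrable_const _).fun_add (hi.div_const 2)) fun ω => ?_
    have := sq_nonneg (L - ‖(g t ω).fst‖)
    simp only
    linarith
  rw [integral_add (integrable_const _) (hi.div_const 2), integral_div 2 fun ω => ‖(g t ω).fst‖ ^ 2] at h1
  have h2 := r.integral_norm_g_fst_sq_le h hy₀ t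
  simp only [integral_const, probReal_univ, one_smul] at h1
  nlinarith [sq_nonneg σ]

theorem integral_mul_norm_sub_le (hηx : 0 ≤ ηx) (hy₀ : y₀ ∈ Y) (s t : ℕ) :
    ∫ ω, L * ‖x (s + t) ω - x s ω‖ ∂P ≤ t * (ηx * (L ^ 2 + σ ^ 2)) := by
  induction t with
  | zero => simp
  | succ t ih =>
    have hi := ((r.memLp_g_fst h hy₀ (s + t)).integrable one_le_two).norm.const_mul L
    have hj := (r.integrable_norm_sub h hy₀ s (s + t)).const_mul L
    have h1 : ∫ ω, L * ‖x (s + (t + 1)) ω - x s ω‖ ∂P ≤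
        ∫ ω, (L * ‖x (s + t) ω - x s ω‖ + ηx * (L * ‖(g (s + t) ω).fst‖)) ∂P := by
      refine integral_mono ((r.integrable_norm_sub h hy₀ s (s + (t + 1))).const_mul L)
        (hj.fun_add (hi.const_mul ηx)) fun ω => ?_
      have e : x (s + (t + 1)) ω - x s ω = (x (s + t) ω - x s ω) - ηx • (g (s + t) ω).fst := by
        rw [← add_assoc, r.x_succ]; abel
      have h2 := norm_sub_le (x (s + t) ω - x s ω) (ηx • (g (s + t) ω).fst)
      rw [norm_smul, Real.norm_of_nonneg hηx, ← e] at h2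
      have h3 := mul_le_mul_of_nonneg_left h2 h.L_pos.le
      simp only
      linarith
    rw [integral_add hj (hi.const_mul ηx), integral_const_mul ηx] at h1
    have h4 := mul_le_mul_of_nonneg_left (r.integral_mul_norm_g_fst_le h hy₀ (s + t)) hηx
    push_cast
    linarith

theorem integrable_apply (hy₀ : y₀ ∈ Y) {z : Ω → Vec n} (hz : Measurable z) (hzY : ∀ ω, z ω ∈ Y)
    (t : ℕ) : Integrable (fun ω => f (x t ω) (z ω)) P := by
  obtain ⟨C, hC⟩ := h.exists_abs_le
  have h1 : Integrable (fun ω => C + L * ‖x t ω‖) P :=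
    (integrable_const C).fun_add (((r.memLp_x h hy₀ t).integrable one_le_two).norm.const_mul L)
  exact h1.mono' (h.continuous_uncurry.measurable.comp
    ((r.measurable_x t).prodMk hz)).aestronglyMeasurable
    (Filter.Eventually.of_forall fun ω => hC _ _ (hzY ω))

theorem integrable_f (hy₀ : y₀ ∈ Y) (t : ℕ) : Integrable (fun ω => f (x t ω) (y t ω)) P :=
  r.integrable_apply h hy₀ (r.measurable_y t) (r.y_mem h hy₀ t) t

theorem integrable_maxFun (hy₀ : y₀ ∈ Y) (t : ℕ) :
    Integrable (fun ω => maxFun f Y (x t ω)) P := by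
  obtain ⟨C, hC⟩ := h.exists_abs_le
  have h1 : Integrable (fun ω => C + L * ‖x t ω‖) P :=
    (integrable_const C).fun_add (((r.memLp_x h hy₀ t).integrable one_le_two).norm.const_mul L)
  refine h1.mono' (h.continuous_maxFun.measurable.comp (r.measurable_x t)).aestronglyMeasurable
    (Filter.Eventually.of_forall fun ω => ?_)
  obtain ⟨z, hz, hxz⟩ := h.exists_eq_maxFun (x t ω)
  rw [← hxz]
  exact hC _ _ hz

theorem integrable_gap (hy₀ : y₀ ∈ Y) (t : ℕ) :
    Integrable (fun ω => maxFun f Y (x t ω) - f (x t ω) (y t ω)) P :=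
  (r.integrable_maxFun h hy₀ t).sub (r.integrable_f h hy₀ t)

theorem integrable_norm_sub_sq (hy₀ : y₀ ∈ Y) {z : Ω → Vec n} (hz : Measurable z)
    (hzY : ∀ ω, z ω ∈ Y) (t : ℕ) : Integrable (fun ω => ‖z ω - y t ω‖ ^ 2) P :=
  (memLp_two_iff_integrable_sq_norm
    (hz.sub (r.measurable_y t)).aestronglyMeasurable).1
    (MemLp.of_bound (hz.sub (r.measurable_y t)).aestronglyMeasurable D
      (Filter.Eventually.of_forall fun ω => h.norm_sub_le (hzY ω) (r.y_mem h hy₀ t ω)))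

/-- The expected primal gap at time `s + t` is bounded by the expected increase of the potential
`f(x, y) - ‖z - y‖² / (2ηy)`, for an approximate maximizer `z` chosen at time `s`. -/
theorem integral_gap_le (hηx : 0 ≤ ηx) (hηy : 0 < ηy) (hy₀ : y₀ ∈ Y)
    (hstep : ηy * ℓ ≤ 1 / 2 ∨ ηy * ℓ ≤ 1 ∧ ∀ t ω, noise f x y g t ω = 0)
    {s : ℕ} {z : Ω → Vec n} (hz : Measurable[ℱ s] z) (hzY : ∀ ω, z ω ∈ Y) {δ : ℝ}
    (hδ : ∀ ω, maxFun f Y (x s ω) ≤ f (x s ω) (z ω) + δ) (t : ℕ) :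
    ∫ ω, (maxFun f Y (x (s + t) ω) - f (x (s + t) ω) (y (s + t) ω)) ∂P ≤
      δ + (2 * t + 1) * (ηx * (L ^ 2 + σ ^ 2)) + ηy * σ ^ 2 +
      ∫ ω, (f (x (s + (t + 1)) ω) (y (s + (t + 1)) ω) -
        ‖z ω - y (s + (t + 1)) ω‖ ^ 2 / (2 * ηy)) ∂P -
      ∫ ω, (f (x (s + t) ω) (y (s + t) ω) - ‖z ω - y (s + t) ω‖ ^ 2 / (2 * ηy)) ∂P := by
  have hzm : Measurable z := hz.mono (ℱ.le s) le_rfl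
  set W : Ω → VecPair m n := fun ω => mkPair 0 (z ω - y (s + t) ω)
  have hWm : Measurable[ℱ (s + t)] W := continuous_mkPair.measurable.comp
    (measurable_const.prodMk ((hz.mono (ℱ.mono (Nat.le_add_right s t)) le_rfl).sub
      (r.y_measurable (s + t))))
  have hWb : ∀ ω, ‖W ω‖ ≤ D := fun ω => by
    rw [norm_mkPair_zero_left]
    exact h.norm_sub_le (hzY ω) (r.y_mem h hy₀ _ ω)
  have hWi := r.integrable_inner_noise (s + t) (hWm.mono (ℱ.le _) le_rfl) hWb
  have hn := r.integrable_noise_sq (s + t)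
  have hpot : ∀ t, Integrable (fun ω => f (x t ω) (y t ω) - ‖z ω - y t ω‖ ^ 2 / (2 * ηy)) P :=
    fun t => (r.integrable_f h hy₀ t).sub ((r.integrable_norm_sub_sq h hy₀ hzm hzY t).div_const _)
  have hg := ((r.memLp_g_fst h hy₀ (s + t)).integrable one_le_two).norm.const_mul L
  have hx := (r.integrable_norm_sub h hy₀ s (s + t)).const_mul L
  have i1 := (integrable_const (μ := P) δ).fun_add (hx.const_mul 2)
  have i2 := i1.fun_add (hpot (s + (t + 1)))
  have i3 := integrable_fun_sub i2 (hpot (s + t))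
  have i4 := i3.fun_add (hn.const_mul ηy)
  have i5 := integrable_fun_sub i4 hWi
  have h1 : ∫ ω, (maxFun f Y (x (s + t) ω) - f (x (s + t) ω) (y (s + t) ω)) ∂P ≤
      ∫ ω, (δ + 2 * (L * ‖x (s + t) ω - x s ω‖) +
        (f (x (s + (t + 1)) ω) (y (s + (t + 1)) ω) -
          ‖z ω - y (s + (t + 1)) ω‖ ^ 2 / (2 * ηy)) -
        (f (x (s + t) ω) (y (s + t) ω) - ‖z ω - y (s + t) ω‖ ^ 2 / (2 * ηy)) +
        ηy * ‖noise f x y g (s + t) ω‖ ^ 2 - inner ℝ (noise f x y g (s + t) ω) (W ω) +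
        ηx * (L * ‖(g (s + t) ω).fst‖)) ∂P := by
    refine integral_mono (r.integrable_gap h hy₀ _) (i5.fun_add (hg.const_mul ηx)) fun ω => ?_
    have h2 := h.gap_le_potential_sub (x (s + t) ω) (r.y_mem h hy₀ (s + t) ω) (hzY ω)
      (g (s + t) ω) hηx hηy (hstep.imp id fun hs => ⟨hs.1, hs.2 (s + t) ω⟩)
    rw [← r.x_succ, ← r.y_succ] at h2
    -- `Φ` and `f(·, z)` are both carried back to time `s`, where `z` is nearly optimal. These two
    -- drifts over `t` steps and the current `x`-step give the factor `2t + 1`.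
    have h3 := h.maxFun_le_add (x (s + t) ω) (x s ω)
    have h4 := (neg_abs_le _).trans' (neg_le_neg (h.lipschitz _ (hzY ω) (x (s + t) ω) (x s ω)))
    have h5 := hδ ω
    simp only [noise, W, ← add_assoc]
    linarith
  rw [integral_add i5 (hg.const_mul ηx), integral_sub i4 hWi,
    integral_add i3 (hn.const_mul ηy), integral_sub i2 (hpot (s + t)),
    integral_add i1 (hpot (s + (t + 1))), integral_add (integrable_const δ) (hx.const_mul 2),
    integral_const_mul 2, integral_const_mul ηx, integral_const_mul ηy,
    r.noise_orthogonal _ W D hWm hWb] at h1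
  have h2 := r.integral_mul_norm_sub_le h hηx hy₀ s t
  have h3 := mul_le_mul_of_nonneg_left (r.integral_mul_norm_g_fst_le h hy₀ (s + t)) hηx
  have h4 := mul_le_mul_of_nonneg_left (r.noise_variance (s + t)) hηy.le
  simp only [integral_const, probReal_univ, one_smul] at h1
  linarith

/-- The primal gap summed over the block `[s, s + b)`, compared with an approximate maximizer `z`
chosen at the beginning of the block. -/
theorem sum_integral_gap_block_le (hηx : 0 ≤ ηx) (hηy : 0 < ηy) (hy₀ : y₀ ∈ Y)
    (hstep : ηy * ℓ ≤ 1 / 2 ∨ ηy * ℓ ≤ 1 ∧ ∀ t ω, noise f x y g t ω = 0)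
    {s : ℕ} {z : Ω → Vec n} (hz : Measurable[ℱ s] z) (hzY : ∀ ω, z ω ∈ Y) {δ : ℝ}
    (hδ : ∀ ω, maxFun f Y (x s ω) ≤ f (x s ω) (z ω) + δ) (b : ℕ) :
    ∑ t ∈ Finset.range b,
      ∫ ω, (maxFun f Y (x (s + t) ω) - f (x (s + t) ω) (y (s + t) ω)) ∂P ≤
      b * δ + b ^ 2 * (ηx * (L ^ 2 + σ ^ 2)) + b * (ηy * σ ^ 2) +
      ∫ ω, f (x (s + b) ω) (y (s + b) ω) ∂P - ∫ ω, f (x s ω) (y s ω) ∂P +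
      (∫ ω, ‖z ω - y s ω‖ ^ 2 ∂P) / (2 * ηy) := by
  have hzm : Measurable z := hz.mono (ℱ.le s) le_rfl
  -- The potential telescopes, and the weights `2t + 1` add up to `b²`.
  have hsum : ∀ b : ℕ, ∑ t ∈ Finset.range b,
      ∫ ω, (maxFun f Y (x (s + t) ω) - f (x (s + t) ω) (y (s + t) ω)) ∂P ≤
      b * δ + b ^ 2 * (ηx * (L ^ 2 + σ ^ 2)) + b * (ηy * σ ^ 2) +
      ∫ ω, (f (x (s + b) ω) (y (s + b) ω) - ‖z ω - y (s + b) ω‖ ^ 2 / (2 * ηy)) ∂P -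
      ∫ ω, (f (x s ω) (y s ω) - ‖z ω - y s ω‖ ^ 2 / (2 * ηy)) ∂P := by
    intro b
    induction b with
    | zero => simp
    | succ b ih =>
      rw [Finset.sum_range_succ]
      have := r.integral_gap_le h hηx hηy hy₀ hstep hz hzY hδ b
      push_cast
      linarith
  have h1 := hsum b
  rw [integral_sub (r.integrable_f h hy₀ _)
      ((r.integrable_norm_sub_sq h hy₀ hzm hzY _).div_const _),
    integral_sub (r.integrable_f h hy₀ _)
      ((r.integrable_norm_sub_sq h hy₀ hzm hzY _).div_const _), integral_div, integral_div] at h1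
  have h2 : 0 ≤ (∫ ω, ‖z ω - y (s + b) ω‖ ^ 2 ∂P) / (2 * ηy) :=
    div_nonneg (integral_nonneg fun ω => sq_nonneg _) (by positivity)
  linarith

end IsNoisyRun

/-! ### The convergence rate -/

/-- A measurable selection of approximate maximizers of `f(x, ·)` over `Y`. -/
theorem SmoothNonconvexConcave.exists_measurable_approx_maximizer {m n : ℕ}
    {f : Vec m → Vec n → ℝ} {Y : Set (Vec n)} {ℓ L D : ℝ}
    (h : SmoothNonconvexConcave f Y ℓ L D) {δ : ℝ} (hδ : 0 < δ) :
    ∃ z : Vec m → Vec n, Measurable z ∧ (∀ x, z x ∈ Y) ∧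
      ∀ x, maxFun f Y x ≤ f x (z x) + δ := by
  classical
  have : Nonempty Y := h.nonempty.to_subtype
  -- The first term of a dense sequence that is strictly within `δ` of the maximum depends
  -- measurably on `x`.
  set d : ℕ → Y := TopologicalSpace.denseSeq Y
  have hex : ∀ x, ∃ k, maxFun f Y x < f x (d k) + δ := by
    intro x
    have hopen : IsOpen {y : Y | maxFun f Y x < f x y + δ} :=
      isOpen_lt continuous_const
        (((h.continuous_right x).comp continuous_subtype_val).add continuous_const)
    obtain ⟨y, hy, hxy⟩ := h.exists_eq_maxFun x
    exact (TopologicalSpace.denseRange_denseSeq Y).exists_mem_open hopen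
      ⟨⟨y, hy⟩, by simp [hxy, hδ]⟩
  refine ⟨fun x => d (Nat.find (hex x)), ?_, fun x => (d _).2, fun x => (Nat.find_spec (hex x)).le⟩
  refine Measurable.find (f := fun k (_ : Vec m) => (d k : Vec n))
    (fun k => measurable_const) (fun k => ?_) hex
  exact measurableSet_lt h.continuous_maxFun.measurable
    ((h.continuous_uncurry.comp (Continuous.prodMk_left (d k : Vec n))).measurable.add_const δ)

namespace IsNoisyRun

variable {m n : ℕ} {f : Vec m → Vec n → ℝ} {Y : Set (Vec n)} {ℓ L D ηx ηy σ : ℝ}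
  {x₀ : Vec m} {y₀ : Vec n} {Ω : Type*} {mΩ : MeasurableSpace Ω} {P : Measure Ω}
  [IsProbabilityMeasure P] {ℱ : Filtration ℕ mΩ} {x : ℕ → Ω → Vec m} {y : ℕ → Ω → Vec n}
  {g : ℕ → Ω → VecPair m n}
  (r : IsNoisyRun f Y ηx ηy σ x₀ y₀ P ℱ x y g) (h : SmoothNonconvexConcave f Y ℓ L D)

include r h

/-- Closes the telescoped sum: the last value of `f` exceeds `Φ(x₀)` by at most the total drift. -/
theorem integral_f_le (hηx : 0 ≤ ηx) (hy₀ : y₀ ∈ Y) (t : ℕ) :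
    ∫ ω, f (x t ω) (y t ω) ∂P ≤ maxFun f Y x₀ + t * (ηx * (L ^ 2 + σ ^ 2)) := by
  have hi := (r.integrable_norm_sub h hy₀ 0 t).const_mul L
  have h1 : ∫ ω, f (x t ω) (y t ω) ∂P ≤ ∫ ω, (maxFun f Y x₀ + L * ‖x t ω - x 0 ω‖) ∂P := by
    refine integral_mono (r.integrable_f h hy₀ t) ((integrable_const _).fun_add hi) fun ω => ?_
    have h2 := h.le_maxFun (x t ω) (r.y_mem h hy₀ t ω)
    have h3 := h.maxFun_le_add (x t ω) (x 0 ω)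
    have h4 : maxFun f Y (x 0 ω) = maxFun f Y x₀ := by rw [r.x_zero]
    simp only
    linarith
  rw [integral_add (integrable_const _) hi] at h1
  have h5 := r.integral_mul_norm_sub_le h hηx hy₀ 0 t
  rw [zero_add] at h5
  simp only [integral_const, probReal_univ, one_smul] at h1
  linarith

/-- The first block uses `y₀`, at distance zero but with slack `Φ(x₀) - f(x₀, y₀)`. Each later block
uses a new `δ`-maximizer and pays at most `D² / (2ηy)` for its distance to `y`. -/
theorem sum_integral_gap_add_le (hηx : 0 ≤ ηx) (hηy : 0 < ηy) (hy₀ : y₀ ∈ Y)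
    (hstep : ηy * ℓ ≤ 1 / 2 ∨ ηy * ℓ ≤ 1 ∧ ∀ t ω, noise f x y g t ω = 0)
    {δ : ℝ} (hδ : 0 < δ) (b B q : ℕ) :
    ∑ t ∈ Finset.range (b + q * B), ∫ ω, (maxFun f Y (x t ω) - f (x t ω) (y t ω)) ∂P ≤
      b * (maxFun f Y x₀ - f x₀ y₀) + q * B * δ +
      (b ^ 2 + q * B ^ 2) * (ηx * (L ^ 2 + σ ^ 2)) + (b + q * B) * (ηy * σ ^ 2) +
      ∫ ω, f (x (b + q * B) ω) (y (b + q * B) ω) ∂P - f x₀ y₀ + q * (D ^ 2 / (2 * ηy)) := by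
  induction q with
  | zero =>
    have h1 := r.sum_integral_gap_block_le h hηx hηy hy₀ hstep (s := 0) (z := fun _ => y₀)
      (δ := maxFun f Y x₀ - f x₀ y₀) measurable_const (fun _ => hy₀)
      (fun ω => by rw [r.x_zero]; linarith) b
    have h2 : ∫ ω, f (x 0 ω) (y 0 ω) ∂P = f x₀ y₀ := by
      simp [r.x_zero, r.y_zero]
    have h3 : ∫ ω, ‖y₀ - y 0 ω‖ ^ 2 ∂P = 0 := by
      simp [r.y_zero]
    rw [h2, h3] at h1
    simp only [zero_add, zero_div, add_zero] at h1
    simp only [Nat.cast_zero, zero_mul, add_zero]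
    linarith
  | succ q ih =>
    obtain ⟨z, hzm, hzY, hz⟩ := h.exists_measurable_approx_maximizer hδ
    have h1 := r.sum_integral_gap_block_le h hηx hηy hy₀ hstep (s := b + q * B)
      (z := fun ω => z (x (b + q * B) ω)) (δ := δ)
      (hzm.comp (r.x_measurable (b + q * B))) (fun ω => hzY _) (fun ω => hz _) B
    have h2 : ∫ ω, ‖z (x (b + q * B) ω) - y (b + q * B) ω‖ ^ 2 ∂P ≤ D ^ 2 := by
      have := integral_mono (r.integrable_norm_sub_sq h hy₀
          (hzm.comp (r.measurable_x (b + q * B)))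
        (fun ω => hzY _) (b + q * B)) (integrable_const (μ := P) (D ^ 2)) fun ω =>
          pow_le_pow_left₀ (norm_nonneg _) (h.norm_sub_le (hzY _) (r.y_mem h hy₀ _ ω)) 2
      simpa using this
    have h3 := div_le_div_of_nonneg_right h2 (by positivity : 0 ≤ 2 * ηy)
    rw [add_mul q 1 B, one_mul, ← add_assoc b (q * B) B, Finset.sum_range_add]
    push_cast
    linarith

/-- The primal gap summed over the first `T` iterations, which are divided into one block of
length `T % B` and `T / B` blocks of length `B`. -/
theorem sum_integral_gap_le (hηx : 0 ≤ ηx) (hηy : 0 < ηy) (hy₀ : y₀ ∈ Y)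
    (hstep : ηy * ℓ ≤ 1 / 2 ∨ ηy * ℓ ≤ 1 ∧ ∀ t ω, noise f x y g t ω = 0)
    {δ : ℝ} (hδ : 0 < δ) {B : ℕ} (hB : 0 < B) (T : ℕ) :
    ∑ t ∈ Finset.range T, ∫ ω, (maxFun f Y (x t ω) - f (x t ω) (y t ω)) ∂P ≤
      B * (maxFun f Y x₀ - f x₀ y₀) + T * (δ + (B + 1) * (ηx * (L ^ 2 + σ ^ 2)) +
        ηy * σ ^ 2 + D ^ 2 / (2 * ηy) / B) := by
  have hT : T % B + T / B * B = T := by rw [mul_comm]; exact Nat.mod_add_div T B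
  have h1 := r.sum_integral_gap_add_le h hηx hηy hy₀ hstep hδ (T % B) B (T / B)
  rw [hT] at h1
  have h2 := r.integral_f_le h hηx hy₀ T
  have hlt : ((T % B : ℕ) : ℝ) + 1 ≤ B := by exact_mod_cast Nat.mod_lt T hB
  have hTr : ((T % B : ℕ) : ℝ) + ((T / B : ℕ) : ℝ) * B = T := by exact_mod_cast hT
  have hb0 : (0 : ℝ) ≤ ((T % B : ℕ) : ℝ) := Nat.cast_nonneg _
  have hq0 : (0 : ℝ) ≤ ((T / B : ℕ) : ℝ) := Nat.cast_nonneg _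
  have hB0 : (0 : ℝ) < B := by exact_mod_cast hB
  generalize ((T % B : ℕ) : ℝ) = b at *
  generalize ((T / B : ℕ) : ℝ) = q at *
  have hgap : 0 ≤ maxFun f Y x₀ - f x₀ y₀ := sub_nonneg.2 (h.le_maxFun x₀ hy₀)
  have hA : 0 ≤ ηx * (L ^ 2 + σ ^ 2) := by positivity
  -- Besides `b` copies of the initial gap from the first block, one more comes from bounding the
  -- final `f` by `Φ(x₀)`; `b < B` leaves room for it.
  have h3 : (b + 1) * (maxFun f Y x₀ - f x₀ y₀) ≤ B * (maxFun f Y x₀ - f x₀ y₀) :=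
    mul_le_mul_of_nonneg_right hlt hgap
  have h4 : q * B * δ ≤ T * δ := mul_le_mul_of_nonneg_right (by linarith) hδ.le
  have h5 : (b ^ 2 + q * B ^ 2) * (ηx * (L ^ 2 + σ ^ 2)) ≤ T * B * (ηx * (L ^ 2 + σ ^ 2)) := by
    refine mul_le_mul_of_nonneg_right ?_ hA
    rw [← hTr]
    nlinarith
  have h6 : q * (D ^ 2 / (2 * ηy)) ≤ T * (D ^ 2 / (2 * ηy) / B) := by
    have hK : 0 ≤ D ^ 2 / (2 * ηy) := by positivity
    rw [← mul_div_assoc (T : ℝ), le_div_iff₀ hB0]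
    calc q * (D ^ 2 / (2 * ηy)) * B = (q * B) * (D ^ 2 / (2 * ηy)) := by ring
      _ ≤ T * (D ^ 2 / (2 * ηy)) := mul_le_mul_of_nonneg_right (by linarith) hK
  rw [hTr] at h1
  linarith

omit h in
omit [IsProbabilityMeasure P] in
-- The gradient has the norm of the Fréchet derivative, which is measurable for every `φ`.
theorem measurable_norm_gradient (φ : Vec m → ℝ) (t : ℕ) :
    Measurable fun ω => ‖gradient φ (x t ω)‖ := by
  have h1 : ∀ v, ‖gradient φ v‖ = ‖fderiv ℝ φ v‖ := fun v => by
    simp [gradient]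
  simp_rw [h1]
  exact (measurable_fderiv ℝ φ).norm.comp (r.measurable_x t)

/-! ### Decrease of the Moreau envelope along a noisy run -/

section Envelope

variable {p : Vec m → Vec m} (hp : ∀ x, IsProx ℓ (maxFun f Y) x (p x))
include hp

omit [IsProbabilityMeasure P] r in
theorem norm_gradient_envelope_le (v : Vec m) :
    ‖gradient (moreauEnvelope (maxFun f Y) (1 / (2 * ℓ))) v‖ ≤ 2 * L := by
  have hℓ := h.ell_pos
  rw [gradient_moreauEnvelope hp hℓ, norm_smul, Real.norm_of_nonneg (by positivity), norm_sub_rev]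
  have h1 := norm_prox_sub_le hp hℓ h.L_pos.le h.maxFun_le_add v
  rw [le_div_iff₀ hℓ] at h1
  linarith

theorem integrable_norm_gradient_sq (t : ℕ) : Integrable
    (fun ω => ‖gradient (moreauEnvelope (maxFun f Y) (1 / (2 * ℓ))) (x t ω)‖ ^ 2) P := by
  refine Integrable.mono' (integrable_const ((2 * L) ^ 2))
    ((r.measurable_norm_gradient _ t).pow_const 2).aestronglyMeasurable
    (Filter.Eventually.of_forall fun ω => ?_)
  rw [Real.norm_of_nonneg (by positivity)]
  exact pow_le_pow_left₀ (norm_nonneg _) (norm_gradient_envelope_le h hp _) 2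

theorem integrable_envelope (hb : BddBelow (Set.range (maxFun f Y))) (hy₀ : y₀ ∈ Y) (t : ℕ) :
    Integrable (fun ω => moreauEnvelope (maxFun f Y) (1 / (2 * ℓ)) (x t ω)) P := by
  have h1 := r.integrable_maxFun h hy₀ t
  have h2 := (integrable_const (μ := P) |⨅ w, maxFun f Y w|).fun_add h1.norm
  refine h2.mono' ((differentiable_moreauEnvelope hp h.ell_pos).continuous.measurable.comp
    (r.measurable_x t)).aestronglyMeasurable (Filter.Eventually.of_forall fun ω => ?_)
  have h3 := iInf_le_moreauEnvelope hp h.ell_pos hb (x t ω)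
  have h4 := moreauEnvelope_le_self hp h.ell_pos (x t ω)
  have h5 := neg_abs_le (⨅ w, maxFun f Y w)
  have h6 := le_abs_self (maxFun f Y (x t ω))
  have h7 := abs_nonneg (⨅ w, maxFun f Y w)
  have h8 := abs_nonneg (maxFun f Y (x t ω))
  simp only [Real.norm_eq_abs]
  exact abs_le.2 ⟨by linarith, by linarith⟩

theorem integral_envelope_succ_le (hb : BddBelow (Set.range (maxFun f Y))) (hηx : 0 ≤ ηx)
    (hy₀ : y₀ ∈ Y) (t : ℕ) :
    ∫ ω, moreauEnvelope (maxFun f Y) (1 / (2 * ℓ)) (x (t + 1) ω) ∂P ≤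
      ∫ ω, moreauEnvelope (maxFun f Y) (1 / (2 * ℓ)) (x t ω) ∂P +
      2 * ηx * ℓ * ∫ ω, (maxFun f Y (x t ω) - f (x t ω) (y t ω)) ∂P -
      ηx / 2 * ∫ ω, ‖gradient (moreauEnvelope (maxFun f Y) (1 / (2 * ℓ))) (x t ω)‖ ^ 2 ∂P +
      ηx ^ 2 * ℓ * (L ^ 2 + σ ^ 2) := by
  -- The proximal displacement is bounded and determined by the past, so its pairing with the noise
  -- has mean zero.
  set W : Ω → VecPair m n := fun ω => mkPair (p (x t ω) - x t ω) 0
  have hWm : Measurable[ℱ t] W := continuous_mkPair.measurable.comp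
    ((((continuous_prox hp h.ell_pos).sub continuous_id).measurable.comp
      (r.x_measurable t)).prodMk measurable_const)
  have hWb : ∀ ω, ‖W ω‖ ≤ L / ℓ := fun ω => by
    rw [norm_mkPair_zero_right]
    exact norm_prox_sub_le hp h.ell_pos h.L_pos.le h.maxFun_le_add _
  have hWi := r.integrable_inner_noise t (hWm.mono (ℱ.le t) le_rfl) hWb
  have hg := (memLp_two_iff_integrable_sq_norm (r.memLp_g_fst h hy₀ t).1).1
    (r.memLp_g_fst h hy₀ t)
  have hM := r.integrable_envelope h hp hb hy₀
  have hG := r.integrable_norm_gradient_sq h hp t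
  have i1 := (hM t).fun_add ((r.integrable_gap h hy₀ t).const_mul (2 * ηx * ℓ))
  have i2 := integrable_fun_sub i1 (hG.const_mul (ηx / 2))
  have i3 := i2.fun_add (hWi.const_mul (2 * ηx * ℓ))
  have h1 := integral_mono (hM (t + 1)) (i3.fun_add (hg.const_mul (ηx ^ 2 * ℓ))) fun ω => by
    have := h.descent_step hp (x t ω) (r.y_mem h hy₀ t ω) (g t ω) hηx
    rw [← r.x_succ] at this
    exact this
  rw [integral_add i3 (hg.const_mul _), integral_add i2 (hWi.const_mul _),
    integral_sub i1 (hG.const_mul _),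
    integral_add (hM t) ((r.integrable_gap h hy₀ t).const_mul _),
    integral_const_mul, integral_const_mul, integral_const_mul, integral_const_mul,
    r.noise_orthogonal t W _ hWm hWb] at h1
  have hℓ := h.ell_pos
  have h2 := mul_le_mul_of_nonneg_left (r.integral_norm_g_fst_sq_le h hy₀ t)
    (by positivity : 0 ≤ ηx ^ 2 * ℓ)
  linarith

/-- The descent inequality telescopes: the envelope starts below `Φ(x₀)` and never falls under `inf
Φ`. -/
theorem sum_integral_norm_gradient_sq_le (hb : BddBelow (Set.range (maxFun f Y))) (hηx : 0 < ηx)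
    (hy₀ : y₀ ∈ Y) (T : ℕ) :
    ∑ t ∈ Finset.range T,
      ∫ ω, ‖gradient (moreauEnvelope (maxFun f Y) (1 / (2 * ℓ))) (x t ω)‖ ^ 2 ∂P ≤
      2 * (maxFun f Y x₀ - ⨅ w, maxFun f Y w) / ηx +
      4 * ℓ * ∑ t ∈ Finset.range T, ∫ ω, (maxFun f Y (x t ω) - f (x t ω) (y t ω)) ∂P +
      T * (2 * (ℓ * (ηx * (L ^ 2 + σ ^ 2)))) := by
  have key : ∀ T : ℕ, ηx / 2 * ∑ t ∈ Finset.range T,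
      ∫ ω, ‖gradient (moreauEnvelope (maxFun f Y) (1 / (2 * ℓ))) (x t ω)‖ ^ 2 ∂P ≤
      maxFun f Y x₀ - ∫ ω, moreauEnvelope (maxFun f Y) (1 / (2 * ℓ)) (x T ω) ∂P +
      2 * ηx * ℓ * ∑ t ∈ Finset.range T, ∫ ω, (maxFun f Y (x t ω) - f (x t ω) (y t ω)) ∂P +
      T * (ηx ^ 2 * ℓ * (L ^ 2 + σ ^ 2)) := by
    intro T
    induction T with
    | zero =>
      have := moreauEnvelope_le_self hp h.ell_pos x₀
      simpa [r.x_zero] using this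
    | succ T ih =>
      have := r.integral_envelope_succ_le h hp hb hηx.le hy₀ T
      rw [Finset.sum_range_succ, Finset.sum_range_succ]
      push_cast
      linarith
  have h1 := key T
  have h2 : ⨅ w, maxFun f Y w ≤
      ∫ ω, moreauEnvelope (maxFun f Y) (1 / (2 * ℓ)) (x T ω) ∂P := by
    have := integral_mono (integrable_const (μ := P) (⨅ w, maxFun f Y w))
      (r.integrable_envelope h hp hb hy₀ T)
      fun ω => iInf_le_moreauEnvelope hp h.ell_pos hb (x T ω)
    simpa using this
  generalize ∑ t ∈ Finset.range T,
      ∫ ω, ‖gradient (moreauEnvelope (maxFun f Y) (1 / (2 * ℓ))) (x t ω)‖ ^ 2 ∂P = G at *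
  generalize ∑ t ∈ Finset.range T, ∫ ω, (maxFun f Y (x t ω) - f (x t ω) (y t ω)) ∂P = S at *
  have h3 : 2 * (maxFun f Y x₀ - ⨅ w, maxFun f Y w) / ηx * ηx =
    2 * (maxFun f Y x₀ - ⨅ w, maxFun f Y w) := div_mul_cancel₀ _ hηx.ne'
  refine le_of_mul_le_mul_right ?_ hηx
  rw [add_mul, add_mul, h3]
  linarith

/-- The mean of `𝔼 ‖∇Φ_{1/2ℓ}(x t)‖²` over the first `T` iterates is at most `ε²` when the step
sizes are small and `T` is large. -/
theorem sum_integral_norm_gradient_sq_le_mul_sq (hb : BddBelow (Set.range (maxFun f Y)))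
    (hηx : 0 < ηx) (hηy : 0 < ηy) (hy₀ : y₀ ∈ Y)
    (hstep : ηy * ℓ ≤ 1 / 2 ∨ ηy * ℓ ≤ 1 ∧ ∀ t ω, noise f x y g t ω = 0)
    {ε : ℝ} (hε : 0 < ε) (hA : ℓ * (ηx * (L ^ 2 + σ ^ 2)) ≤ ε ^ 2 / 80)
    (hD : ℓ ^ 2 * D ^ 2 * (ηx * (L ^ 2 + σ ^ 2)) ≤ ηy * ε ^ 4 / 4096)
    (hσ : ℓ * (ηy * σ ^ 2) ≤ ε ^ 2 / 32) {T : ℕ}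
    (hT : 2 * (maxFun f Y x₀ - ⨅ w, maxFun f Y w) / ηx +
      4 * ℓ * (maxFun f Y x₀ - f x₀ y₀) * (1 + 32 * (ℓ * D ^ 2 / (ηy * ε ^ 2))) ≤
      T * ε ^ 2 / 2) :
    ∑ t ∈ Finset.range T,
      ∫ ω, ‖gradient (moreauEnvelope (maxFun f Y) (1 / (2 * ℓ))) (x t ω)‖ ^ 2 ∂P ≤
      T * ε ^ 2 := by
  have hℓ := h.ell_pos
  have hDpos := h.D_pos
  -- `β` is the real block length at which the renewal cost `D² / (2ηy β)` equals `ε² / (64ℓ)`.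
  set β := 32 * (ℓ * D ^ 2 / (ηy * ε ^ 2)) with hβ
  have hβ0 : 0 < β := by positivity
  set B := ⌈β⌉₊
  have hB : 0 < B := Nat.ceil_pos.2 hβ0
  have hBβ : β ≤ B := Nat.le_ceil β
  have hB1 : (B : ℝ) ≤ β + 1 := (Nat.ceil_lt_add_one hβ0.le).le
  have hBr : (0 : ℝ) < B := by exact_mod_cast hB
  have h1 := r.sum_integral_norm_gradient_sq_le h hp hb hηx hy₀ T
  have h2 := r.sum_integral_gap_le h hηx.le hηy hy₀ hstep
    (δ := ε ^ 2 / (40 * ℓ)) (by positivity) hB T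
  have hgap : 0 ≤ maxFun f Y x₀ - f x₀ y₀ := sub_nonneg.2 (h.le_maxFun x₀ hy₀)
  set A := ηx * (L ^ 2 + σ ^ 2)
  have hA0 : 0 ≤ A := by positivity
  have e1 : 4 * ℓ * (ε ^ 2 / (40 * ℓ)) = ε ^ 2 / 10 := by field_simp; norm_num
  have e2 : 4 * ℓ * (D ^ 2 / (2 * ηy) / B) ≤ ε ^ 2 / 16 := by
    have : D ^ 2 / (2 * ηy) * (64 * ℓ) = β * ε ^ 2 := by rw [hβ]; field_simp; norm_num
    have h3 : D ^ 2 / (2 * ηy) / B ≤ ε ^ 2 / (64 * ℓ) := by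
      rw [div_le_div_iff₀ hBr (by positivity), this, mul_comm]
      exact mul_le_mul_of_nonneg_left hBβ (by positivity)
    calc _ ≤ 4 * ℓ * (ε ^ 2 / (64 * ℓ)) := mul_le_mul_of_nonneg_left h3 (by positivity)
      _ = ε ^ 2 / 16 := by field_simp; norm_num
  have e3 : 4 * ℓ * (B * A) ≤ ε ^ 2 / 20 + ε ^ 2 / 32 := by
    have h3 : ℓ * A * β ≤ ε ^ 2 / 128 := by
      have : ℓ * A * β = 32 * (ℓ ^ 2 * D ^ 2 * A) / (ηy * ε ^ 2) := by rw [hβ]; field_simp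
      rw [this, div_le_iff₀ (by positivity)]
      linear_combination 32 * hD
    have h4 := mul_le_mul_of_nonneg_left hB1 (mul_nonneg hℓ.le hA0)
    linarith
  have h3 := mul_le_mul_of_nonneg_left h2 (by positivity : 0 ≤ 4 * ℓ)
  have h4 : 4 * ℓ * (B * (maxFun f Y x₀ - f x₀ y₀)) ≤
      4 * ℓ * (maxFun f Y x₀ - f x₀ y₀) * (1 + β) := by
    have := mul_le_mul_of_nonneg_left hB1 (mul_nonneg (by positivity : 0 ≤ 4 * ℓ) hgap)
    linarith
  -- In units of `ε²` the errors are `1/10`, `1/20 + 1/32 + 1/20` (drift), `1/8` (noise), `1/16`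
  -- (renewal) and `1/40`, in total `71/160`. The other half of `ε²` is left to the initial terms in
  -- `hT`.
  have h5 : 4 * ℓ * (ε ^ 2 / (40 * ℓ) + (B + 1) * A + ηy * σ ^ 2 + D ^ 2 / (2 * ηy) / B) +
      2 * (ℓ * A) ≤ ε ^ 2 / 2 := by
    have : 0 < ε ^ 2 := by positivity
    linarith
  have h6 := mul_le_mul_of_nonneg_left h5 (Nat.cast_nonneg T : (0 : ℝ) ≤ T)
  linarith

end Envelope

end IsNoisyRun

/-! ### TTSGDA and TTGDA as noisy runs -/

section Stochastic

variable {m n : ℕ} {Ξ Ω : Type*} [MeasurableSpace Ξ] [mΩ : MeasurableSpace Ω]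
  {f : Vec m → Vec n → ℝ} {Y : Set (Vec n)} {G : Vec m → Vec n → Ξ → VecPair m n}
  {ν : Measure Ξ} {ℓ L D σ ηx ηy : ℝ} {x₀ : Vec m} {y₀ : Vec n} {P : Measure Ω}
  {ξ : ℕ → Fin 1 → Ω → Ξ}

/-- The σ-algebras generated by the samples of the first `t` iterations. -/
def sampleFiltration {M : ℕ} {ξ : ℕ → Fin M → Ω → Ξ} (hξ : ∀ t i, Measurable (ξ t i)) :
    Filtration ℕ mΩ where
  seq t := ⨆ p ∈ {p : ℕ × Fin M | p.1 < t}, MeasurableSpace.comap (ξ p.1 p.2) inferInstance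
  mono' _ _ hst := biSup_mono fun _ hp => lt_of_lt_of_le hp hst
  le' _ := iSup₂_le fun p _ => (hξ p.1 p.2).comap_le

theorem measurable_sample_sampleFiltration {M : ℕ} {ξ : ℕ → Fin M → Ω → Ξ}
    (hξ : ∀ t i, Measurable (ξ t i)) {s t : ℕ} (hst : s < t) (i : Fin M) :
    Measurable[sampleFiltration hξ t] (ξ s i) := by
  rw [measurable_iff_comap_le]
  exact le_iSup₂_of_le (f := fun (p : ℕ × Fin M) (_ : p ∈ {p : ℕ × Fin M | p.1 < t}) =>
    MeasurableSpace.comap (ξ p.1 p.2) inferInstance) (s, i) hst le_rfl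

/-- A fresh sample is independent of everything determined by earlier ones. The product law allows
Fubini to replace conditional expectations. -/
theorem IsSampling.map_prodMk {M : ℕ} {ξ : ℕ → Fin M → Ω → Ξ} [IsProbabilityMeasure P]
    (hS : IsSampling P ν ξ) {α : Type*} [MeasurableSpace α] {t : ℕ} {U : Ω → α}
    (hU : Measurable[sampleFiltration hS.measurable t] U) (i : Fin M) :
    P.map (fun ω => (U ω, ξ t i ω)) = (P.map U).prod ν := by
  have hle := (sampleFiltration hS.measurable).le t
  have hindep : IndepFun U (ξ t i) P := by
    have h1 := indep_iSup_of_disjoint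
      (m := fun p : ℕ × Fin M => MeasurableSpace.comap (ξ p.1 p.2) inferInstance)
      (fun p => (hS.measurable p.1 p.2).comap_le) hS.indep
      (S := {p | p.1 < t}) (T := {(t, i)}) (by simp)
    have h2 := indep_of_indep_of_le_left h1 hU.comap_le
    rw [IndepFun_iff_Indep]
    simpa using h2
  rw [(indepFun_iff_map_prod_eq_prod_map_map (hU.mono hle le_rfl).aemeasurable
    (hS.measurable t i).aemeasurable).1 hindep, hS.law]

omit [MeasurableSpace Ξ] in
theorem SG_one (s : Fin 1 → Ξ) (x : Vec m) (y : Vec n) : SG G s x y = G x y (s 0) := by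
  simp [SG]

theorem measurable_ttsgda (hG : Measurable fun p : Vec m × Vec n × Ξ => G p.1 p.2.1 p.2.2)
    (h : SmoothNonconvexConcave f Y ℓ L D) (hξ : ∀ t i, Measurable (ξ t i)) (t : ℕ) :
    Measurable[sampleFiltration hξ t] fun ω =>
      ((ttsgda G Y (fun _ => ηx) (fun _ => ηy) x₀ y₀ (fun t i => ξ t i ω) t).x,
        (ttsgda G Y (fun _ => ηx) (fun _ => ηy) x₀ y₀ (fun t i => ξ t i ω) t).y) := by
  induction t with
  | zero =>
    simp only [ttsgda]
    exact measurable_const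
  | succ t ih =>
    have ih' := ih.mono ((sampleFiltration hξ).mono (Nat.le_succ t)) le_rfl
    have hs := measurable_sample_sampleFiltration hξ (Nat.lt_succ_self t) 0
    have hg := hG.comp (ih'.fst.prodMk (ih'.snd.prodMk hs))
    simp only [ttsgda, State.step, SG_one]
    refine Measurable.prodMk ?_ ?_
    · exact ih'.fst.sub (((WithLp.continuous_fst 2 _ _).measurable.comp hg).const_smul ηx)
    · exact (continuous_proj h.closed h.nonempty h.convex).measurable.comp
        (ih'.snd.add (((WithLp.continuous_snd 2 _ _).measurable.comp hg).const_smul ηy))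

theorem IsStochasticGradient.lintegral_le (hG : IsStochasticGradient f Y G ν σ) (x : Vec m)
    {y : Vec n} (hy : y ∈ Y) :
    ∫⁻ s, ENNReal.ofReal (‖G x y s - grad f x y‖ ^ 2) ∂ν ≤ ENNReal.ofReal (σ ^ 2) := by
  have := hG.isProbabilityMeasure
  have h1 : MemLp (fun s => G x y s - grad f x y) 2 ν :=
    (hG.square_integrable x y hy).sub (memLp_const _)
  have h2 := (memLp_two_iff_integrable_sq_norm h1.1).1 h1
  rw [← ofReal_integral_eq_lintegral_ofReal h2 (Filter.Eventually.of_forall fun _ => sq_nonneg _)]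
  have h3 := hG.variance_le x y hy
  rw [hG.unbiased x y hy] at h3
  exact ENNReal.ofReal_le_ofReal h3

theorem IsStochasticGradient.integral_inner_eq_zero (hG : IsStochasticGradient f Y G ν σ)
    (x : Vec m) {y : Vec n} (hy : y ∈ Y) (w : VecPair m n) :
    ∫ s, inner ℝ (G x y s - grad f x y) w ∂ν = 0 := by
  have := hG.isProbabilityMeasure
  have h1 : Integrable (fun s => G x y s) ν :=
    (hG.square_integrable x y hy).integrable one_le_two
  simp_rw [real_inner_comm w]
  rw [integral_inner (integrable_fun_sub h1 (integrable_const _)), integral_sub h1 (integrable_const _),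
    hG.unbiased x y hy]
  simp

/-- TTSGDA with one sample per iteration is a noisy run. -/
theorem isNoisyRun_ttsgda [IsProbabilityMeasure P] (h : SmoothNonconvexConcave f Y ℓ L D)
    (hG : IsStochasticGradient f Y G ν σ) (hS : IsSampling P ν ξ) (hy₀ : y₀ ∈ Y) :
    IsNoisyRun f Y ηx ηy σ x₀ y₀ P (sampleFiltration hS.measurable)
      (fun t ω => (ttsgda G Y (fun _ => ηx) (fun _ => ηy) x₀ y₀ (fun t i => ξ t i ω) t).x)
      (fun t ω => (ttsgda G Y (fun _ => ηx) (fun _ => ηy) x₀ y₀ (fun t i => ξ t i ω) t).y)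
      (fun t ω => G
        (ttsgda G Y (fun _ => ηx) (fun _ => ηy) x₀ y₀ (fun t i => ξ t i ω) t).x
        (ttsgda G Y (fun _ => ηx) (fun _ => ηy) x₀ y₀ (fun t i => ξ t i ω) t).y (ξ t 0 ω)) := by
  have hprob := hG.isProbabilityMeasure
  set ℱ := sampleFiltration hS.measurable
  have hxy : ∀ t, Measurable[ℱ t] fun ω =>
      ((ttsgda G Y (fun _ => ηx) (fun _ => ηy) x₀ y₀ (fun t i => ξ t i ω) t).x,
        (ttsgda G Y (fun _ => ηx) (fun _ => ηy) x₀ y₀ (fun t i => ξ t i ω) t).y) :=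
    measurable_ttsgda hG.measurable h hS.measurable
  have hyY : ∀ t ω,
      (ttsgda G Y (fun _ => ηx) (fun _ => ηy) x₀ y₀ (fun t i => ξ t i ω) t).y ∈ Y := by
    intro t ω
    cases t with
    | zero => exact hy₀
    | succ t => exact (proj_spec Y h.closed h.nonempty _).1
  have hxs : ∀ t ω, (ttsgda G Y (fun _ => ηx) (fun _ => ηy) x₀ y₀ (fun t i => ξ t i ω) (t + 1)).x =
      (ttsgda G Y (fun _ => ηx) (fun _ => ηy) x₀ y₀ (fun t i => ξ t i ω) t).x - ηx • (G
        (ttsgda G Y (fun _ => ηx) (fun _ => ηy) x₀ y₀ (fun t i => ξ t i ω) t).x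
        (ttsgda G Y (fun _ => ηx) (fun _ => ηy) x₀ y₀ (fun t i => ξ t i ω) t).y (ξ t 0 ω)).fst := by
    intro t ω
    simp only [ttsgda, State.step, SG_one]
  have hys : ∀ t ω, (ttsgda G Y (fun _ => ηx) (fun _ => ηy) x₀ y₀ (fun t i => ξ t i ω) (t + 1)).y =
      proj Y ((ttsgda G Y (fun _ => ηx) (fun _ => ηy) x₀ y₀ (fun t i => ξ t i ω) t).y + ηy • (G
        (ttsgda G Y (fun _ => ηx) (fun _ => ηy) x₀ y₀ (fun t i => ξ t i ω) t).x
        (ttsgda G Y (fun _ => ηx) (fun _ => ηy) x₀ y₀ (fun t i => ξ t i ω) t).y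
          (ξ t 0 ω)).snd) := by
    intro t ω
    simp only [ttsgda, State.step, SG_one]
  have hx0 : ∀ ω, (ttsgda G Y (fun _ => ηx) (fun _ => ηy) x₀ y₀ (fun t i => ξ t i ω) 0).x = x₀ :=
    fun _ => rfl
  have hy0 : ∀ ω, (ttsgda G Y (fun _ => ηx) (fun _ => ηy) x₀ y₀ (fun t i => ξ t i ω) 0).y = y₀ :=
    fun _ => rfl
  -- From here on the iterates matter only through the measurability, feasibility and recursion
  -- facts above.
  generalize hX : (fun t ω =>
    (ttsgda G Y (fun _ => ηx) (fun _ => ηy) x₀ y₀ (fun t i => ξ t i ω) t).x) = X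
  generalize hV : (fun t ω =>
    (ttsgda G Y (fun _ => ηx) (fun _ => ηy) x₀ y₀ (fun t i => ξ t i ω) t).y) = V
  have eX : ∀ t ω,
    (ttsgda G Y (fun _ => ηx) (fun _ => ηy) x₀ y₀ (fun t i => ξ t i ω) t).x = X t ω := by
    simp [← hX]
  have eV : ∀ t ω,
    (ttsgda G Y (fun _ => ηx) (fun _ => ηy) x₀ y₀ (fun t i => ξ t i ω) t).y = V t ω := by
    simp [← hV]
  simp only [eX, eV] at hxy hyY hxs hys hx0 hy0 ⊢
  clear hX hV eX eV
  have herr : Measurable fun q : (Vec m × Vec n) × Ξ => G q.1.1 q.1.2 q.2 - grad f q.1.1 q.1.2 :=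
    (hG.measurable.comp (measurable_fst.fst.prodMk (measurable_fst.snd.prodMk measurable_snd))).sub
      ((continuous_grad_of_isSmooth h.smooth).measurable.comp measurable_fst)
  have hnoise : ∀ t, Measurable (noise f X V (fun t ω => G (X t ω) (V t ω) (ξ t 0 ω)) t) :=
    fun t => herr.comp (((hxy t).mono (ℱ.le t) le_rfl).prodMk (hS.measurable t 0))
  -- Tonelli needs no integrability, so this variance bound comes first and then supplies square
  -- integrability of the noise.
  have hlint : ∀ t, ∫⁻ ω, ENNReal.ofReal
      (‖noise f X V (fun t ω => G (X t ω) (V t ω) (ξ t 0 ω)) t ω‖ ^ 2) ∂P ≤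
      ENNReal.ofReal (σ ^ 2) := by
    intro t
    have hm : Measurable fun q : (Vec m × Vec n) × Ξ =>
        ENNReal.ofReal (‖G q.1.1 q.1.2 q.2 - grad f q.1.1 q.1.2‖ ^ 2) :=
      (herr.norm.pow_const 2).ennreal_ofReal
    have h1 := lintegral_map (μ := P) hm
      (((hxy t).mono (ℱ.le t) le_rfl).prodMk (hS.measurable t 0))
    rw [hS.map_prodMk (hxy t) 0, lintegral_prod _ hm.aemeasurable,
      lintegral_map hm.lintegral_prod_right' ((hxy t).mono (ℱ.le t) le_rfl)] at h1
    refine h1.symm.le.trans ?_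
    calc _ ≤ ∫⁻ _, ENNReal.ofReal (σ ^ 2) ∂P :=
          lintegral_mono fun ω => hG.lintegral_le (X t ω) (hyY t ω)
      _ = _ := by simp
  have hint : ∀ t, Integrable
      (fun ω => ‖noise f X V (fun t ω => G (X t ω) (V t ω) (ξ t 0 ω)) t ω‖ ^ 2) P := by
    intro t
    refine ⟨((hnoise t).norm.pow_const 2).aestronglyMeasurable, ?_⟩
    rw [hasFiniteIntegral_iff_ofReal (Filter.Eventually.of_forall fun _ => sq_nonneg _)]
    exact (hlint t).trans_lt ENNReal.ofReal_lt_top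
  have hmem : ∀ t, MemLp (noise f X V (fun t ω => G (X t ω) (V t ω) (ξ t 0 ω)) t) 2 P := fun t =>
    (memLp_two_iff_integrable_sq_norm (hnoise t).aestronglyMeasurable).2 (hint t)
  refine ⟨hx0, hy0, hxs, hys, fun t => (hxy t).fst, fun t => (hxy t).snd, hmem, fun t => ?_,
    fun t W C hW hC => ?_⟩
  · have h1 := hlint t
    rw [← ofReal_integral_eq_lintegral_ofReal (hint t)
      (Filter.Eventually.of_forall fun _ => sq_nonneg _)] at h1
    exact (ENNReal.ofReal_le_ofReal_iff (sq_nonneg σ)).1 h1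
  · have hWm := hW.mono (ℱ.le t) le_rfl
    -- The test vector joins the past variables, so that the fresh sample is independent of the
    -- triple.
    have hU : Measurable[ℱ t] fun ω => ((X t ω, V t ω), W ω) := (hxy t).prodMk hW
    have hUm := hU.mono (ℱ.le t) le_rfl
    have hF : Measurable fun q : ((Vec m × Vec n) × VecPair m n) × Ξ =>
        (inner ℝ (G q.1.1.1 q.1.1.2 q.2 - grad f q.1.1.1 q.1.1.2) q.1.2 : ℝ) :=
      (herr.comp (measurable_fst.fst.prodMk measurable_snd)).inner measurable_fst.snd
    have hpair := hUm.prodMk (hS.measurable t 0)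
    have hi : Integrable (fun ω => (inner ℝ
        (noise f X V (fun t ω => G (X t ω) (V t ω) (ξ t 0 ω)) t ω) (W ω) : ℝ)) P := by
      refine (((hmem t).integrable one_le_two).norm.mul_const C).mono'
        ((hnoise t).inner hWm).aestronglyMeasurable
        (Filter.Eventually.of_forall fun ω => (norm_inner_le_norm _ _).trans ?_)
      exact mul_le_mul_of_nonneg_left (hC ω) (norm_nonneg _)
    have h1 := integral_map (μ := P) hpair.aemeasurable hF.aestronglyMeasurable
    have h2 := (integrable_map_measure (μ := P) hF.aestronglyMeasurable hpair.aemeasurable).2 hi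
    rw [hS.map_prodMk hU 0] at h1 h2
    rw [integral_prod _ h2] at h1
    refine h1.symm.trans (integral_eq_zero_of_ae ?_)
    -- Unbiasedness is assumed only for `y ∈ Y`, so the inner integral vanishes almost everywhere
    -- for the law of the past.
    have hY : ∀ᵐ u ∂P.map (fun ω => ((X t ω, V t ω), W ω)), u.1.2 ∈ Y :=
      (ae_map_iff hUm.aemeasurable (h.closed.measurableSet.preimage measurable_fst.snd)).2
        (Filter.Eventually.of_forall fun ω => hyY t ω)
    filter_upwards [hY] with u hu
    exact hG.integral_inner_eq_zero u.1.1 hu u.2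

end Stochastic

/-- TTGDA is a noisy run without noise. -/
theorem isNoisyRun_ttgda {m n : ℕ} {f : Vec m → Vec n → ℝ} {Y : Set (Vec n)} {ηx ηy : ℝ}
    {x₀ : Vec m} {y₀ : Vec n} :
    IsNoisyRun f Y ηx ηy 0 x₀ y₀ (Measure.dirac ()) (Filtration.const ℕ inferInstance le_rfl)
      (fun t _ => (ttgda f Y (fun _ => ηx) (fun _ => ηy) x₀ y₀ t).x)
      (fun t _ => (ttgda f Y (fun _ => ηx) (fun _ => ηy) x₀ y₀ t).y)
      (fun t _ => grad f (ttgda f Y (fun _ => ηx) (fun _ => ηy) x₀ y₀ t).x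
        (ttgda f Y (fun _ => ηx) (fun _ => ηy) x₀ y₀ t).y) where
  x_zero _ := rfl
  y_zero _ := rfl
  x_succ _ _ := rfl
  y_succ _ _ := rfl
  x_measurable _ := measurable_const
  y_measurable _ := measurable_const
  noise_memLp t := (memLp_const 0).ae_eq (Filter.Eventually.of_forall fun ω => by simp [noise])
  noise_variance t := by simp [noise]
  noise_orthogonal t W C _ _ := by simp [noise]

/-! ### The random output index -/

instance (T : ℕ) : IsProbabilityMeasure (uniformIndex T) := by
  unfold uniformIndex; infer_instance

theorem integral_uniformIndex (T : ℕ) (u : Fin (T + 1) → ℝ) :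
    ∫ k, u k ∂uniformIndex T = (∑ k, u k) / (T + 1) := by
  unfold uniformIndex
  rw [PMF.integral_eq_sum, Finset.sum_div]
  refine Finset.sum_congr rfl fun k _ => ?_
  rw [PMF.uniformOfFintype_apply, Fintype.card_fin, smul_eq_mul, ENNReal.toReal_inv,
    ENNReal.toReal_natCast]
  push_cast
  ring

theorem integral_uniformIndex_le {T : ℕ} {u : ℕ → ℝ} {c : ℝ}
    (hu : ∑ t ∈ Finset.range (T + 1), u t ≤ ((T + 1 : ℕ) : ℝ) * c) :
    ∫ k : Fin (T + 1), u k ∂uniformIndex T ≤ c := by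
  rw [integral_uniformIndex T fun k => u k, Fin.sum_univ_eq_sum_range u (T + 1),
    div_le_iff₀ (by positivity)]
  push_cast at hu
  linarith

theorem exists_le_of_sum_le {T : ℕ} {u : ℕ → ℝ} {c : ℝ}
    (hu : ∑ t ∈ Finset.range (T + 1), u t ≤ ((T + 1 : ℕ) : ℝ) * c) : ∃ t ≤ T, u t ≤ c := by
  have h1 : ∑ t ∈ Finset.range (T + 1), u t ≤ ∑ _t ∈ Finset.range (T + 1), c := by
    simpa using hu
  obtain ⟨t, ht, htc⟩ := Finset.exists_le_of_sum_le (Finset.nonempty_range_add_one) h1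
  exact ⟨t, Nat.lt_succ_iff.1 (Finset.mem_range.1 ht), htc⟩

theorem integrable_prod_uniformIndex {Ω : Type*} [MeasurableSpace Ω] {P : Measure Ω}
    [IsProbabilityMeasure P] {T : ℕ} {u : ℕ → Ω → ℝ} {C : ℝ} (hu : ∀ t, Measurable (u t))
    (hC : ∀ t ω, ‖u t ω‖ ≤ C) :
    Integrable (fun q : Ω × Fin (T + 1) => u q.2 q.1) (P.prod (uniformIndex T)) := by
  refine Integrable.mono' (integrable_const C) (Measurable.aestronglyMeasurable ?_)
    (Filter.Eventually.of_forall fun q => hC _ _)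
  exact measurable_from_prod_countable_left fun k : Fin (T + 1) => hu k

/-! ### Step sizes and iteration counts -/

section StepSizes

variable {ℓ L D σ ε : ℝ}

/-- Each entry of the minimum enforces one smallness condition; the bound on the inverse follows by
cases on which entry attains it. -/
theorem etaX_bounds (hℓ : 0 < ℓ) (hL : 0 < L) (hD : 0 < D) (hε : 0 < ε) :
    0 < etaX ℓ L D ε ∧ ℓ * (etaX ℓ L D ε * L ^ 2) ≤ ε ^ 2 / 80 ∧
      ℓ ^ 2 * D ^ 2 * (etaX ℓ L D ε * L ^ 2) ≤ 1 / ℓ * ε ^ 4 / 4096 ∧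
      1 / etaX ℓ L D ε ≤ 4096 * (ℓ * L ^ 2 / ε ^ 2) * max 1 (ℓ ^ 2 * D ^ 2 / ε ^ 2) := by
  have h1 : etaX ℓ L D ε ≤ ε ^ 2 / (80 * ℓ * L ^ 2) := min_le_left _ _
  have h2 : etaX ℓ L D ε ≤ ε ^ 4 / (4096 * ℓ ^ 3 * L ^ 2 * D ^ 2) := min_le_right _ _
  have h0 : 0 < etaX ℓ L D ε := lt_min (by positivity) (by positivity)
  rw [le_div_iff₀ (by positivity)] at h1 h2
  refine ⟨h0, by linarith, ?_, ?_⟩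
  · rw [one_div_mul_eq_div, div_div, le_div_iff₀ (by positivity)]
    linarith
  · have hK : 0 < ℓ * L ^ 2 / ε ^ 2 := by positivity
    rcases min_choice (ε ^ 2 / (80 * ℓ * L ^ 2)) (ε ^ 4 / (4096 * ℓ ^ 3 * L ^ 2 * D ^ 2)) with h | h
    · have e : 1 / etaX ℓ L D ε = 80 * (ℓ * L ^ 2 / ε ^ 2) := by
        rw [etaX, h]; field_simp
      have := mul_le_mul_of_nonneg_left (le_max_left 1 (ℓ ^ 2 * D ^ 2 / ε ^ 2)) hK.le
      rw [e]
      linarith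
    · have e : 1 / etaX ℓ L D ε = 4096 * (ℓ * L ^ 2 / ε ^ 2) * (ℓ ^ 2 * D ^ 2 / ε ^ 2) := by
        rw [etaX, h]; field_simp
      rw [e]
      exact mul_le_mul_of_nonneg_left (le_max_right _ _) (by positivity)

/-- The two entries ensure the ascent condition and the noise budget. The disjunction keeps track of
the active entry, on which both the block length and the drift condition depend. -/
theorem etaYStoch_bounds (hℓ : 0 < ℓ) (hε : 0 < ε) :
    0 < etaYStoch ℓ σ ε ∧ etaYStoch ℓ σ ε * ℓ ≤ 1 / 2 ∧
      ℓ * (etaYStoch ℓ σ ε * σ ^ 2) ≤ ε ^ 2 / 32 ∧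
      (1 / etaYStoch ℓ σ ε = 2 * ℓ ∨ σ ≠ 0 ∧ 1 / etaYStoch ℓ σ ε = 32 * ℓ * σ ^ 2 / ε ^ 2) := by
  unfold etaYStoch
  split_ifs with hσ
  · subst hσ
    refine ⟨by positivity, le_of_eq (by field_simp), ?_, Or.inl (by field_simp)⟩
    simp only [ne_eq, OfNat.ofNat_ne_zero, not_false_eq_true, zero_pow, mul_zero]
    positivity
  · have h0 : 0 < min (1 / (2 * ℓ)) (ε ^ 2 / (32 * ℓ * σ ^ 2)) :=
      lt_min (by positivity) (by positivity)
    have h1 := min_le_left (1 / (2 * ℓ)) (ε ^ 2 / (32 * ℓ * σ ^ 2))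
    have h2 := min_le_right (1 / (2 * ℓ)) (ε ^ 2 / (32 * ℓ * σ ^ 2))
    have h3 := min_choice (1 / (2 * ℓ)) (ε ^ 2 / (32 * ℓ * σ ^ 2))
    generalize min (1 / (2 * ℓ)) (ε ^ 2 / (32 * ℓ * σ ^ 2)) = η at *
    rw [le_div_iff₀ (by positivity)] at h1 h2
    refine ⟨h0, by linarith, by linarith, ?_⟩
    rcases h3 with h3 | h3
    · exact Or.inl (by rw [h3]; field_simp)
    · exact Or.inr ⟨hσ, by rw [h3]; field_simp⟩

/-- The drift condition has constant `4096` and involves `ηy`. Inserting `ηy = 1/(2ℓ)` gives `8192 =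
2 · 4096`, and `ηy = ε²/(32ℓσ²)` gives `131072 = 32 · 4096`. -/
theorem etaXStoch_bounds (hℓ : 0 < ℓ) (hL : 0 < L) (hD : 0 < D) (hε : 0 < ε) :
    0 < etaXStoch ℓ L D σ ε ∧ ℓ * (etaXStoch ℓ L D σ ε * (L ^ 2 + σ ^ 2)) ≤ ε ^ 2 / 80 ∧
      ℓ ^ 3 * D ^ 2 * (etaXStoch ℓ L D σ ε * (L ^ 2 + σ ^ 2)) ≤ ε ^ 4 / 8192 ∧
      ℓ ^ 3 * D ^ 2 * σ ^ 2 * (etaXStoch ℓ L D σ ε * (L ^ 2 + σ ^ 2)) ≤ ε ^ 6 / 131072 ∧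
      1 / etaXStoch ℓ L D σ ε ≤ 131072 * (ℓ * (L ^ 2 + σ ^ 2) / ε ^ 2) *
        max 1 (max (ℓ ^ 2 * D ^ 2 / ε ^ 2) (ℓ ^ 2 * D ^ 2 * σ ^ 2 / ε ^ 4)) := by
  set κ := max 1 (max (ℓ ^ 2 * D ^ 2 / ε ^ 2) (ℓ ^ 2 * D ^ 2 * σ ^ 2 / ε ^ 4))
  have hκ1 : 1 ≤ κ := le_max_left _ _
  have hκ2 : ℓ ^ 2 * D ^ 2 / ε ^ 2 ≤ κ := (le_max_left _ _).trans (le_max_right _ _)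
  have hκ3 : ℓ ^ 2 * D ^ 2 * σ ^ 2 / ε ^ 4 ≤ κ := (le_max_right _ _).trans (le_max_right _ _)
  have hS : 0 < L ^ 2 + σ ^ 2 := by positivity
  unfold etaXStoch
  generalize L ^ 2 + σ ^ 2 = S at *
  have hK : 0 < ℓ * S / ε ^ 2 := by positivity
  have b1 : 1 / (ε ^ 2 / (80 * ℓ * S)) ≤ 131072 * (ℓ * S / ε ^ 2) * κ := by
    have e : 1 / (ε ^ 2 / (80 * ℓ * S)) = 80 * (ℓ * S / ε ^ 2) := by field_simp
    have := mul_le_mul_of_nonneg_left hκ1 hK.le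
    rw [e]
    linarith
  have b2 : 1 / (ε ^ 4 / (8192 * ℓ ^ 3 * S * D ^ 2)) ≤ 131072 * (ℓ * S / ε ^ 2) * κ := by
    have e : 1 / (ε ^ 4 / (8192 * ℓ ^ 3 * S * D ^ 2)) =
      8192 * ((ℓ * S / ε ^ 2) * (ℓ ^ 2 * D ^ 2 / ε ^ 2)) := by field_simp
    have := mul_le_mul_of_nonneg_left hκ2 hK.le
    have : 0 ≤ ℓ * S / ε ^ 2 * κ := by positivity
    rw [e]
    linarith
  split_ifs with hσ
  · have h0 : 0 < min (ε ^ 2 / (80 * ℓ * S)) (ε ^ 4 / (8192 * ℓ ^ 3 * S * D ^ 2)) :=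
      lt_min (by positivity) (by positivity)
    have h1 := min_le_left (ε ^ 2 / (80 * ℓ * S)) (ε ^ 4 / (8192 * ℓ ^ 3 * S * D ^ 2))
    have h2 := min_le_right (ε ^ 2 / (80 * ℓ * S)) (ε ^ 4 / (8192 * ℓ ^ 3 * S * D ^ 2))
    have h3 := min_choice (ε ^ 2 / (80 * ℓ * S)) (ε ^ 4 / (8192 * ℓ ^ 3 * S * D ^ 2))
    generalize min (ε ^ 2 / (80 * ℓ * S)) (ε ^ 4 / (8192 * ℓ ^ 3 * S * D ^ 2)) = η at *
    rw [le_div_iff₀ (by positivity)] at h1 h2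
    refine ⟨h0, by linarith, by linarith, ?_, ?_⟩
    · rw [hσ]
      simp only [ne_eq, OfNat.ofNat_ne_zero, not_false_eq_true, zero_pow, mul_zero, zero_mul]
      positivity
    · rcases h3 with h3 | h3 <;> rw [h3] <;> assumption
  · have b3 : 1 / (ε ^ 6 / (131072 * ℓ ^ 3 * S * D ^ 2 * σ ^ 2)) ≤
        131072 * (ℓ * S / ε ^ 2) * κ := by
      have e : 1 / (ε ^ 6 / (131072 * ℓ ^ 3 * S * D ^ 2 * σ ^ 2)) =
        131072 * (ℓ * S / ε ^ 2) * (ℓ ^ 2 * D ^ 2 * σ ^ 2 / ε ^ 4) := by field_simp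
      rw [e]
      exact mul_le_mul_of_nonneg_left hκ3 (by positivity)
    have p1 : 0 < ε ^ 2 / (80 * ℓ * S) := by positivity
    have p2 : 0 < ε ^ 4 / (8192 * ℓ ^ 3 * S * D ^ 2) := by positivity
    have p3 : 0 < ε ^ 6 / (131072 * ℓ ^ 3 * S * D ^ 2 * σ ^ 2) := by positivity
    have h0 := lt_min p1 (lt_min p2 p3)
    have h1 := min_le_left (ε ^ 2 / (80 * ℓ * S)) (min (ε ^ 4 / (8192 * ℓ ^ 3 * S * D ^ 2))
      (ε ^ 6 / (131072 * ℓ ^ 3 * S * D ^ 2 * σ ^ 2)))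
    have h2 := min_le_right (ε ^ 2 / (80 * ℓ * S)) (min (ε ^ 4 / (8192 * ℓ ^ 3 * S * D ^ 2))
      (ε ^ 6 / (131072 * ℓ ^ 3 * S * D ^ 2 * σ ^ 2)))
    have h3 := h2.trans (min_le_right _ _)
    replace h2 := h2.trans (min_le_left _ _)
    have h4 := min_choice (ε ^ 2 / (80 * ℓ * S)) (min (ε ^ 4 / (8192 * ℓ ^ 3 * S * D ^ 2))
      (ε ^ 6 / (131072 * ℓ ^ 3 * S * D ^ 2 * σ ^ 2)))
    have h5 := min_choice (ε ^ 4 / (8192 * ℓ ^ 3 * S * D ^ 2))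
      (ε ^ 6 / (131072 * ℓ ^ 3 * S * D ^ 2 * σ ^ 2))
    generalize min (ε ^ 2 / (80 * ℓ * S)) (min (ε ^ 4 / (8192 * ℓ ^ 3 * S * D ^ 2))
      (ε ^ 6 / (131072 * ℓ ^ 3 * S * D ^ 2 * σ ^ 2))) = η at *
    rw [le_div_iff₀ (by positivity)] at h1 h2 h3
    refine ⟨h0, by linarith, by linarith, by linarith, ?_⟩
    rcases h4 with h4 | h4
    · rw [h4]; exact b1
    · rcases h5 with h5 | h5 <;> rw [h4, h5] <;> assumption

/-- More than `2²⁰ (ℓSΔ_Φ/ε⁴ + ℓΔ₀/ε²) κ` iterations are enough, if `1/ηx ≤ 2¹⁷ (ℓS/ε²) κ` and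
`ℓD²/(ηy ε²) ≤ 32 κ`. -/
theorem iterations_le {S κ ΔΦ Δ₀ ηx ηy T : ℝ} (hℓ : 0 < ℓ) (hε : 0 < ε) (hκ : 1 ≤ κ)
    (hS : 0 < S) (hΦ : 0 ≤ ΔΦ) (h₀ : 0 ≤ Δ₀) (hx : 1 / ηx ≤ 131072 * (ℓ * S / ε ^ 2) * κ)
    (hy : ℓ * D ^ 2 / (ηy * ε ^ 2) ≤ 32 * κ)
    (hT : 1048576 * ((ℓ * S * ΔΦ / ε ^ 4 + ℓ * Δ₀ / ε ^ 2) * κ) ≤ T) :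
    2 * ΔΦ / ηx + 4 * ℓ * Δ₀ * (1 + 32 * (ℓ * D ^ 2 / (ηy * ε ^ 2))) ≤ T * ε ^ 2 / 2 := by
  have h1 := mul_le_mul_of_nonneg_left hx (by positivity : 0 ≤ 2 * ΔΦ)
  -- `1025 = 1 + 32 · 32`, using `κ ≥ 1`. Both `4 · 1025` and `2 · 2¹⁷` are below `2¹⁹`, half of the
  -- constant in `hT`.
  have h2 : 1 + 32 * (ℓ * D ^ 2 / (ηy * ε ^ 2)) ≤ 1025 * κ := by linarith
  have h3 := mul_le_mul_of_nonneg_left h2 (by positivity : 0 ≤ 4 * ℓ * Δ₀)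
  have h4 := mul_le_mul_of_nonneg_right hT (by positivity : 0 ≤ ε ^ 2 / 2)
  have e : 1048576 * ((ℓ * S * ΔΦ / ε ^ 4 + ℓ * Δ₀ / ε ^ 2) * κ) * (ε ^ 2 / 2) =
      524288 * (ΔΦ * (ℓ * S / ε ^ 2 * κ)) + 524288 * (ℓ * Δ₀ * κ) := by
    field_simp
    ring
  have h5 : 0 ≤ ΔΦ * (ℓ * S / ε ^ 2 * κ) := by positivity
  have h6 : 0 ≤ ℓ * Δ₀ * κ := by positivity
  rw [e] at h4
  rw [mul_one_div] at h1
  linarith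

end StepSizes

/-! ### Counting gradient evaluations -/

theorem ttgda_evals {m n : ℕ} (f : Vec m → Vec n → ℝ) (Y : Set (Vec n)) (ηx ηy : ℕ → ℝ)
    (x₀ : Vec m) (y₀ : Vec n) (t : ℕ) : (ttgda f Y ηx ηy x₀ y₀ t).evals = t := by
  induction t with
  | zero => rfl
  | succ t ih => simp [ttgda, State.step, ih]

theorem ttsgda_evals {m n M : ℕ} {Ξ : Type*} (G : Vec m → Vec n → Ξ → VecPair m n)
    (Y : Set (Vec n)) (ηx ηy : ℕ → ℝ) (x₀ : Vec m) (y₀ : Vec n) (ξ : ℕ → Fin M → Ξ) (t : ℕ) :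
    (ttsgda G Y ηx ηy x₀ y₀ ξ t).evals = t * M := by
  induction t with
  | zero => simp [ttsgda]
  | succ t ih => simp [ttsgda, State.step, ih, add_mul]

end TwoTimescale

end

open TwoTimescale in
/-- The constant `C` is absolute: it is chosen before all problem data. In both parts a run whose
number of (stochastic) gradient evaluations is at most `C` times the bound, and every longer run,
returns an `ε`-stationary point of `Φ`, where the returned point is drawn uniformly from
`x_0, …, x_T`. -/
theorem mainTheorem3 :
    ∃ C : ℝ, 0 < C ∧
      ∀ (m n : ℕ) (f : Vec m → Vec n → ℝ) (Y : Set (Vec n)) (ℓ L D ε : ℝ)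
        (x₀ : Vec m) (y₀ : Vec n),
        SmoothNonconvexConcave f Y ℓ L D → 0 < ε → y₀ ∈ Y →
        BddBelow (Set.range (maxFun f Y)) →
        ∀ ΔΦ Δ₀ : ℝ, ΔΦ = maxFun f Y x₀ - (⨅ x, maxFun f Y x) →
          Δ₀ = maxFun f Y x₀ - f x₀ y₀ →
        -- TTGDA
        (∃ N : ℕ,
          let run := ttgda f Y (fun _ => etaX ℓ L D ε) (fun _ => 1 / ℓ) x₀ y₀
          ((run N).evals : ℝ) ≤ C * boundDet ℓ L D ΔΦ Δ₀ ε ∧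
          ∀ T : ℕ, N ≤ T →
            IsStationaryInMeanSquare (uniformIndex T) (maxFun f Y) ℓ ε
              (fun k : Fin (T + 1) => (run k).x) ∧
            ∃ t ≤ T, IsStationary (maxFun f Y) ℓ ε (run t).x) ∧
        -- TTSGDA with `M = 1`
        (∀ (Ξ : Type*) [MeasurableSpace Ξ] (G : Vec m → Vec n → Ξ → VecPair m n)
          (ν : Measure Ξ) (σ : ℝ), IsStochasticGradient f Y G ν σ →
          ∀ (Ω : Type*) [MeasurableSpace Ω] (P : Measure Ω) [IsProbabilityMeasure P]
            (ξ : ℕ → Fin 1 → Ω → Ξ), IsSampling P ν ξ →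
          ∃ N : ℕ,
            let run := fun ω : Ω => ttsgda G Y (fun _ => etaXStoch ℓ L D σ ε)
              (fun _ => etaYStoch ℓ σ ε) x₀ y₀ (fun t i => ξ t i ω)
            (∀ ω, ((run ω N).evals : ℝ) ≤ C * boundStoch ℓ L D σ ΔΦ Δ₀ ε) ∧
            ∀ T : ℕ, N ≤ T →
              IsStationaryInMeanSquare (P.prod (uniformIndex T)) (maxFun f Y) ℓ ε
                (fun p : Ω × Fin (T + 1) => (run p.1 p.2).x)) := by
  refine ⟨1048576, by norm_num, ?_⟩
  intro m n f Y ℓ L D ε x₀ y₀ h hε hy₀ hb ΔΦ Δ₀ hΔΦ hΔ₀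
  have hℓ := h.ell_pos
  have hL := h.L_pos
  have hD := h.D_pos
  have hΦ : 0 ≤ ΔΦ := by rw [hΔΦ]; exact sub_nonneg.2 (ciInf_le hb x₀)
  have h₀ : 0 ≤ Δ₀ := by rw [hΔ₀]; exact sub_nonneg.2 (h.le_maxFun x₀ hy₀)
  have hwc := h.isWeaklyConvex
  choose p hp using hwc.exists_isProx hℓ h.continuous_maxFun hb
  have hdiff := differentiable_moreauEnvelope hp hℓ
  constructor
  · obtain ⟨hηx, hA, hηD, hinv⟩ := etaX_bounds hℓ hL hD hε
    have hκ : 1 ≤ max 1 (ℓ ^ 2 * D ^ 2 / ε ^ 2) := le_max_left _ _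
    have hκ' : ℓ ^ 2 * D ^ 2 / ε ^ 2 ≤ max 1 (ℓ ^ 2 * D ^ 2 / ε ^ 2) := le_max_right _ _
    have hbound : 0 ≤ boundDet ℓ L D ΔΦ Δ₀ ε := by unfold boundDet; positivity
    -- Rounding down keeps the evaluations within the bound. The average runs over `T + 1` iterates,
    -- so `T ≥ N` still gives more iterates than the unrounded bound.
    refine ⟨⌊1048576 * boundDet ℓ L D ΔΦ Δ₀ ε⌋₊, ?_, fun T hT => ?_⟩
    · rw [ttgda_evals]
      exact Nat.floor_le (by positivity)
    have hT' : 1048576 * boundDet ℓ L D ΔΦ Δ₀ ε ≤ ((T + 1 : ℕ) : ℝ) :=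
      (Nat.lt_of_floor_lt (Nat.lt_succ_of_le hT)).le
    -- The constant is weakened so that `iterations_le` serves both algorithms.
    have hinv' : 1 / etaX ℓ L D ε ≤
        131072 * (ℓ * L ^ 2 / ε ^ 2) * max 1 (ℓ ^ 2 * D ^ 2 / ε ^ 2) := by
      refine hinv.trans (mul_le_mul_of_nonneg_right ?_ (by positivity))
      exact mul_le_mul_of_nonneg_right (by norm_num) (by positivity)
    have hy : ℓ * D ^ 2 / (1 / ℓ * ε ^ 2) ≤ 32 * max 1 (ℓ ^ 2 * D ^ 2 / ε ^ 2) := by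
      have e : ℓ * D ^ 2 / (1 / ℓ * ε ^ 2) = ℓ ^ 2 * D ^ 2 / ε ^ 2 := by field_simp
      rw [e]
      linarith
    have hiter := iterations_le hℓ hε hκ (by positivity) hΦ h₀ hinv' hy hT'
    rw [hΔΦ, hΔ₀] at hiter
    have key := (isNoisyRun_ttgda (f := f) (Y := Y) (ηx := etaX ℓ L D ε) (ηy := 1 / ℓ) (x₀ := x₀)
      (y₀ := y₀)).sum_integral_norm_gradient_sq_le_mul_sq h hp hb hηx (by positivity) hy₀
      (Or.inr ⟨by rw [one_div_mul_cancel hℓ.ne'], fun t ω => by simp [noise]⟩) hε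
      (by simpa using hA) (by simpa using hηD)
      (by simp only [ne_eq, OfNat.ofNat_ne_zero, not_false_eq_true, zero_pow, mul_zero]; positivity)
      hiter
    simp only [integral_const, probReal_univ, one_smul] at key
    refine ⟨⟨hwc, hdiff, Integrable.of_finite, integral_uniformIndex_le key⟩, ?_⟩
    obtain ⟨t, htT, ht⟩ := exists_le_of_sum_le key
    exact ⟨t, htT, hwc, hdiff _, (abs_le_of_sq_le_sq' ht hε.le).2⟩
  · intro Ξ _ G ν σ hG Ω _ P _ ξ hS
    obtain ⟨hηx, hA, hηD, hηDσ, hinv⟩ := etaXStoch_bounds (σ := σ) hℓ hL hD hε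
    obtain ⟨hηy, hstep, hσ, hηy'⟩ := etaYStoch_bounds (σ := σ) hℓ hε
    set κ := max 1 (max (ℓ ^ 2 * D ^ 2 / ε ^ 2) (ℓ ^ 2 * D ^ 2 * σ ^ 2 / ε ^ 4))
    have hκ1 : 1 ≤ κ := le_max_left _ _
    have hκ2 : ℓ ^ 2 * D ^ 2 / ε ^ 2 ≤ κ := (le_max_left _ _).trans (le_max_right _ _)
    have hκ3 : ℓ ^ 2 * D ^ 2 * σ ^ 2 / ε ^ 4 ≤ κ := (le_max_right _ _).trans (le_max_right _ _)
    have hbound : 0 ≤ boundStoch ℓ L D σ ΔΦ Δ₀ ε := by unfold boundStoch; positivity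
    refine ⟨⌊1048576 * boundStoch ℓ L D σ ΔΦ Δ₀ ε⌋₊, fun ω => ?_, fun T hT => ?_⟩
    · rw [ttsgda_evals, mul_one]
      exact Nat.floor_le (by positivity)
    have hT' : 1048576 * boundStoch ℓ L D σ ΔΦ Δ₀ ε ≤ ((T + 1 : ℕ) : ℝ) :=
      (Nat.lt_of_floor_lt (Nat.lt_succ_of_le hT)).le
    have hyD : ∀ c : ℝ, c / etaYStoch ℓ σ ε = c * (1 / etaYStoch ℓ σ ε) :=
      fun c => (mul_one_div _ _).symm
    have hy : ℓ * D ^ 2 / (etaYStoch ℓ σ ε * ε ^ 2) ≤ 32 * κ := by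
      rw [mul_comm (etaYStoch ℓ σ ε), ← div_div, hyD]
      rcases hηy' with e | ⟨_, e⟩
      · rw [e]
        have : ℓ * D ^ 2 / ε ^ 2 * (2 * ℓ) = 2 * (ℓ ^ 2 * D ^ 2 / ε ^ 2) := by field_simp
        linarith
      · rw [e]
        have : ℓ * D ^ 2 / ε ^ 2 * (32 * ℓ * σ ^ 2 / ε ^ 2) =
          32 * (ℓ ^ 2 * D ^ 2 * σ ^ 2 / ε ^ 4) := by field_simp
        linarith
    have hDη : ℓ ^ 2 * D ^ 2 * (etaXStoch ℓ L D σ ε * (L ^ 2 + σ ^ 2)) ≤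
        etaYStoch ℓ σ ε * ε ^ 4 / 4096 := by
      suffices ℓ ^ 2 * D ^ 2 * (etaXStoch ℓ L D σ ε * (L ^ 2 + σ ^ 2)) / etaYStoch ℓ σ ε ≤
          ε ^ 4 / 4096 by
        rw [div_le_iff₀ hηy] at this
        linarith
      rw [hyD]
      rcases hηy' with e | ⟨_, e⟩
      · rw [e]
        linarith
      · rw [e, ← mul_div_assoc, div_le_iff₀ (by positivity)]
        linarith
    have hiter := iterations_le hℓ hε hκ1 (by positivity) hΦ h₀ hinv hy hT'
    rw [hΔΦ, hΔ₀] at hiter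
    have r := isNoisyRun_ttsgda (ηx := etaXStoch ℓ L D σ ε) (ηy := etaYStoch ℓ σ ε)
      (x₀ := x₀) h hG hS hy₀
    have key := r.sum_integral_norm_gradient_sq_le_mul_sq h hp hb hηx hηy hy₀ (Or.inl hstep) hε
      hA hDη hσ hiter
    have hi := integrable_prod_uniformIndex (P := P) (T := T) (C := (2 * L) ^ 2)
      (fun t => (r.measurable_norm_gradient
        (moreauEnvelope (maxFun f Y) (1 / (2 * ℓ))) t).pow_const 2) fun t ω => by
        rw [Real.norm_of_nonneg (by positivity)]
        exact pow_le_pow_left₀ (norm_nonneg _)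
          (IsNoisyRun.norm_gradient_envelope_le h hp _) 2
    refine ⟨hwc, hdiff, hi, ?_⟩
    -- Integrating over the samples first leaves the uniform average of the means bounded by `key`.
    rw [integral_prod_symm _ hi]
    exact integral_uniformIndex_le key
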